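/- Let $m,r,q,l\ge 0$ be integers, $H$ a probability distribution on $(0,\infty)$ with $k_1=\int u^{-1/2}\,dH(u)<\infty$, $\mathbf X_i\in\mathbb R^{m\times l}$, $\mathbf X_i^+\in\mathbb R^{r\times l}$, $\mathbf Z_i\in\mathbb R^{m\times q}$, $\mathbf Z_i^+\in\mathbb R^{r\times q}$ design matrices, $\boldsymbol\beta\in\mathbb R^l$, $\boldsymbol\lambda\in\mathbb R^q$, and $\mathbf D\in\mathbb R^{q\times q}$, $\boldsymbol\Sigma_i^*\in\mathbb R^{(m+r)\times(m+r)}$ symmetric positive definite. Put $$c=-\sqrt{2/\pi}\,k_1,\quad \boldsymbol\Delta=\frac{\mathbf D^{1/2}\boldsymbol\lambda}{\sqrt{1+\boldsymbol\lambda^\top\boldsymbol\lambda}},\quad \boldsymbol\zeta=\mathbf D^{-1/2}\boldsymbol\lambda,\quad \mathbf X_i^*=\begin{pmatrix}\mathbf X_i\\ \mathbf X_i^+\end{pmatrix},\quad \mathbf Z_i^*=\begin{pmatrix}\mathbf Z_i\\ \mathbf Z_i^+\end{pmatrix},$$ $$\boldsymbol\Psi_i^*=\boldsymbol\Sigma_i^*+\mathbf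 Z_i^*\mathbf D\mathbf Z_i^{*\top}=\begin{pmatrix}\boldsymbol\Psi^*_{i11}&\boldsymbol\Psi^*_{i12}\\ \boldsymbol\Psi^*_{i21}&\boldsymbol\Psi^*_{i22}\end{pmatrix},\quad \boldsymbol\Lambda_i^*=(\mathbf D^{-1}+\mathbf Z_i^{*\top}\boldsymbol\Sigma_i^{*-1}\mathbf Z_i^*)^{-1},\quad \bar{\boldsymbol\lambda}_i^*=\frac{\boldsymbol\Psi_i^{*-1/2}\mathbf Z_i^*\mathbf D\boldsymbol\zeta}{\sqrt{1+\boldsymbol\zeta^\top\boldsymbol\Lambda_i^*\boldsymbol\zeta}},$$ where all matrix square roots are the positive semidefinite ones. Suppose that the observed vector $\mathbf Y_i\in\mathbb R^m$ and the future vector $\mathbf Y_i^+\in\mathbb R^r$ satisfy $$\begin{pmatrix}\mathbf Y_i\\ \mathbf Y_i^+\end{pmatrix}\sim \mathrm{SMSN}_{m+r}\left(\mathbf X_i^*\boldsymbol\beta+c\,\mathbf Z_i^*\boldsymbol\Delta,\ \boldsymbol\Psi_i^*,\ \bar{\boldsymbol\lambda}_i^*;\ H\right)$$ with scale mixing variable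 $U_i$. Here $\mathbf V\sim\mathrm{SMSN}_p(\boldsymbol\mu,\boldsymbol\Sigma,\boldsymbol\lambda;H)$ with mixing variable $U$ means that $U\sim H$ and that, given $U=u$, $\mathbf V$ has the density $2\,\phi_p(\mathbf v;\boldsymbol\mu,u^{-1}\boldsymbol\Sigma)\,\Phi\!\left(u^{1/2}\boldsymbol\lambda^\top\boldsymbol\Sigma^{-1/2}(\mathbf v-\boldsymbol\mu)\right)$, where $\phi_p(\cdot;\boldsymbol\mu,\boldsymbol\Sigma)$ is the $p$-variate normal density with mean $\boldsymbol\mu$ and covariance matrix $\boldsymbol\Sigma$, and $\Phi$ is the standard normal cdf. Let the observations $\mathbf Y_{(i)}$ of the other subjects be independent of $(\mathbf Y_i,\mathbf Y_i^+)$. Write $\boldsymbol\upsilon_i=\boldsymbol\Psi_i^{*-1/2}\bar{\boldsymbol\lambda}_i^*=(\boldsymbol\upsilon_i^{(1)\top},\boldsymbol\upsilon_i^{(2)\top})^\top$ (blocks of sizes $m$ and $r$), $\boldsymbol\Psi^*_{i22.1}=\boldsymbol\Psi^*_{i22}-\boldsymbol\Psi^*_{i21}\boldsymbol\Psi_{i11}^{*-1}\boldsymbol\Psi^*_{i12}$,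 $$\widetilde{\boldsymbol\upsilon}_i=\frac{\boldsymbol\upsilon_i^{(1)}+\boldsymbol\Psi_{i11}^{*-1}\boldsymbol\Psi^*_{i12}\boldsymbol\upsilon_i^{(2)}}{\sqrt{1+\boldsymbol\upsilon_i^{(2)\top}\boldsymbol\Psi^*_{i22.1}\boldsymbol\upsilon_i^{(2)}}},\qquad W_\Phi=\phi_1/\Phi$$ with $\phi_1$ the standard normal density, $$\boldsymbol\mu_{i2.1}(\mathbf y_i)=\mathbf X_i^+\boldsymbol\beta+c\,\mathbf Z_i^+\boldsymbol\Delta+\boldsymbol\Psi^*_{i21}\boldsymbol\Psi_{i11}^{*-1}(\mathbf y_i-\mathbf X_i\boldsymbol\beta-c\,\mathbf Z_i\boldsymbol\Delta),$$ $$\widetilde\tau_{-1i}(\mathbf y_i)=\mathrm E\left\{U_i^{-1/2}\,W_\Phi\!\left(U_i^{1/2}\,\widetilde{\boldsymbol\upsilon}_i^\top(\mathbf Y_i-\mathbf X_i\boldsymbol\beta-c\,\mathbf Z_i\boldsymbol\Delta)\right)\,\middle|\,\mathbf Y_i=\mathbf y_i\right\}.$$ Then, for almost every $\mathbf y_i$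 with respect to the law of $\mathbf Y_i$, the conditional expectations $\mathrm E\{\mathbf Y_i^+\mid\mathbf Y_i=\mathbf y_i\}$ and $\widetilde\tau_{-1i}(\mathbf y_i)$ exist, and $$\mathrm E\{\mathbf Y_i^+\mid\mathbf Y_i=\mathbf y_i\}=\boldsymbol\mu_{i2.1}(\mathbf y_i)+\frac{\widetilde\tau_{-1i}(\mathbf y_i)\,\boldsymbol\Psi^*_{i22.1}\boldsymbol\upsilon_i^{(2)}}{\sqrt{1+\boldsymbol\upsilon_i^{(2)\top}\boldsymbol\Psi^*_{i22.1}\boldsymbol\upsilon_i^{(2)}}}=:\widehat{\mathbf Y}_i^+(\mathbf y_i).$$ Moreover $\widehat{\mathbf Y}_i^+(\mathbf Y_i)$ is the minimum mean squared error predictor of $\mathbf Y_i^+$, both among the measurable functions of $\mathbf Y_i$ and among the measurable functions of all the data $(\mathbf Y_i,\mathbf Y_{(i)})$: no such function $g$ has a smaller error $\mathrm E\|\mathbf Y_i^+-g\|^2\in[0,\infty]$, and any $g$ of finite error that does as well equals $\widehat{\mathbf Y}_i^+(\mathbf Y_i)$ almost surely. -/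

import Mathlib

open MeasureTheory ProbabilityTheory Matrix
open scoped MatrixOrder ENNReal

noncomputable section

namespace SMSN

/-- The cdf `Φ` of the standard normal distribution. -/
def Phi (x : ℝ) : ℝ := cdf (gaussianReal 0 1) x

/-- `W_Φ(x) = φ₁(x) / Φ(x)`. -/
def WPhi (x : ℝ) : ℝ := gaussianPDFReal 0 1 x / Phi x

section Density

variable {ι : Type*} [Fintype ι] [DecidableEq ι]

/-- The density `φ_p(y; μ, S)` of the `p`-variate normal distribution with mean `μ` and
covariance matrix `S`, where `p` is the number of elements of `ι`. -/
def normalPDF (mu : ι → ℝ) (S : Matrix ι ι ℝ) (y : ι → ℝ) : ℝ :=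
  (√((2 * Real.pi) ^ Fintype.card ι * S.det))⁻¹ *
    Real.exp (-((y - mu) ⬝ᵥ (S⁻¹ *ᵥ (y - mu))) / 2)

/-- The conditional density of `Y` given `U = u`, that is, of `SN_p(μ, u⁻¹ S, lam)`:
`2 φ_p(y; μ, u⁻¹ S) Φ(u^{1/2} lamᵀ S^{-1/2} (y - μ))`. Here `S^{-1/2}` is the positive
semidefinite square root of `S⁻¹`. -/
def condPDF (mu : ι → ℝ) (S : Matrix ι ι ℝ) (lam : ι → ℝ) (u : ℝ) (y : ι → ℝ) : ℝ :=
  2 * normalPDF mu (u⁻¹ • S) y * Phi (√u * (lam ⬝ᵥ (CFC.sqrt S⁻¹ *ᵥ (y - mu))))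

/-- The density of `SMSN_p(μ, S, lam; H)`: the mixture `∫ condPDF μ S lam u y dH(u)`. -/
def pdf (mu : ι → ℝ) (S : Matrix ι ι ℝ) (lam : ι → ℝ) (H : Measure ℝ) (y : ι → ℝ) : ℝ≥0∞ :=
  ∫⁻ u, ENNReal.ofReal (condPDF mu S lam u y) ∂H

/-- `Y ∼ SMSN_p(μ, S, lam; H)` with scale mixing variable `U`: `U` has distribution `H`, and the
conditional law of `Y` given `U = u` has the density `condPDF μ S lam u`; the pair `(U, Y)` thus
has the density `(u, y) ↦ condPDF μ S lam u y` with respect to the product of `H` and the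
Lebesgue measure. In particular `Y` has the density `pdf μ S lam H`
(see `IsSMSN.map_eq_withDensity_pdf`). -/
structure IsSMSN {Ω : Type*} [MeasurableSpace Ω] (P : Measure Ω) (Y : Ω → ι → ℝ) (U : Ω → ℝ)
    (mu : ι → ℝ) (S : Matrix ι ι ℝ) (lam : ι → ℝ) (H : Measure ℝ) : Prop where
  map_mixing : P.map U = H
  map_joint : P.map (fun ω => (U ω, Y ω)) =
    (H.prod (volume : Measure (ι → ℝ))).withDensity
      (fun p => ENNReal.ofReal (condPDF mu S lam p.1 p.2))

theorem measurable_Phi : Measurable Phi := (monotone_cdf _).measurable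

theorem measurable_condPDF (mu : ι → ℝ) (S : Matrix ι ι ℝ) (lam : ι → ℝ) :
    Measurable (fun p : ℝ × (ι → ℝ) => condPDF mu S lam p.1 p.2) := by
  have hinv : ∀ u : ℝ, (u⁻¹ • S)⁻¹ = Ring.inverse (u⁻¹ • S).det • (u⁻¹ • S).adjugate :=
    fun u => Matrix.inv_def _
  have hsub : ∀ i, Measurable (fun p : ℝ × (ι → ℝ) => p.2 i - mu i) := fun i => by fun_prop
  unfold condPDF normalPDF
  refine (measurable_const.mul (Measurable.mul ?_ ?_)).mul (measurable_Phi.comp ?_)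
  · simp only [Matrix.det_smul]
    fun_prop
  · simp only [hinv, Ring.inverse_eq_inv', Matrix.det_smul, Matrix.adjugate_smul, dotProduct,
      mulVec, Matrix.smul_apply, smul_eq_mul, Pi.sub_apply]
    fun_prop
  · simp only [dotProduct, mulVec, Pi.sub_apply]
    fun_prop

/-- An `SMSN` vector has the `SMSN` density. -/
theorem IsSMSN.map_eq_withDensity_pdf {Ω : Type*} [MeasurableSpace Ω] {P : Measure Ω}
    {Y : Ω → ι → ℝ} {U : Ω → ℝ} {mu : ι → ℝ} {S : Matrix ι ι ℝ} {lam : ι → ℝ} {H : Measure ℝ}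
    [SFinite H] (hY : Measurable Y) (hU : Measurable U) (h : IsSMSN P Y U mu S lam H) :
    P.map Y = volume.withDensity (pdf mu S lam H) := by
  have h1 : P.map Y = (P.map (fun ω => (U ω, Y ω))).map Prod.snd := by
    rw [Measure.map_map measurable_snd (hU.prodMk hY)]
    rfl
  have hm : Measurable (fun p : ℝ × (ι → ℝ) => ENNReal.ofReal (condPDF mu S lam p.1 p.2)) :=
    (measurable_condPDF mu S lam).ennreal_ofReal
  rw [h1, h.map_joint]
  ext s hs
  rw [Measure.map_apply measurable_snd hs, withDensity_apply _ (measurable_snd hs),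
    withDensity_apply _ hs, ← Set.univ_prod, ← Measure.prod_restrict,
    Measure.restrict_univ, lintegral_prod_symm _ hm.aemeasurable]
  rfl

end Density

/-- The parameters of the linear mixed model for one subject with `m` observed and `r` future
measurements, `l` fixed effects and `q` random effects. `Sigma` is the error dispersion matrix of
the stacked vector of all `m + r` measurements. -/
structure Model (l q m r : ℕ) where
  X : Matrix (Fin m) (Fin l) ℝ
  Xp : Matrix (Fin r) (Fin l) ℝ
  Z : Matrix (Fin m) (Fin q) ℝ
  Zp : Matrix (Fin r) (Fin q) ℝ
  beta : Fin l → ℝ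
  D : Matrix (Fin q) (Fin q) ℝ
  lam : Fin q → ℝ
  Sigma : Matrix (Fin m ⊕ Fin r) (Fin m ⊕ Fin r) ℝ
  H : Measure ℝ

namespace Model

variable {l q m r : ℕ} (M : Model l q m r)

/-- `k₁ = E U^{-1/2}`. -/
def k₁ : ℝ := ∫ u, (√u)⁻¹ ∂M.H

/-- `c = -√(2/π) k₁`. -/
def c : ℝ := -√(2 / Real.pi) * M.k₁

/-- `δ = lam / √(1 + lamᵀ lam)`. -/
def delta : Fin q → ℝ := (√(1 + M.lam ⬝ᵥ M.lam))⁻¹ • M.lam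

/-- `Δ = D^{1/2} δ`. -/
def Delta : Fin q → ℝ := CFC.sqrt M.D *ᵥ M.delta

/-- `ζ = D^{-1/2} lam`. -/
def zeta : Fin q → ℝ := CFC.sqrt M.D⁻¹ *ᵥ M.lam

/-- The stacked design matrix `X*`. -/
def Xstar : Matrix (Fin m ⊕ Fin r) (Fin l) ℝ := fromRows M.X M.Xp

/-- The stacked design matrix `Z*`. -/
def Zstar : Matrix (Fin m ⊕ Fin r) (Fin q) ℝ := fromRows M.Z M.Zp

/-- The location vector `X* β + c Z* Δ`. -/
def loc : Fin m ⊕ Fin r → ℝ := M.Xstar *ᵥ M.beta + M.c • (M.Zstar *ᵥ M.Delta)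

/-- `Ψ* = Σ* + Z* D Z*ᵀ`. -/
def Psi : Matrix (Fin m ⊕ Fin r) (Fin m ⊕ Fin r) ℝ := M.Sigma + M.Zstar * M.D * M.Zstarᵀ

/-- `Λ* = (D⁻¹ + Z*ᵀ Σ*⁻¹ Z*)⁻¹`. -/
def Lambda : Matrix (Fin q) (Fin q) ℝ := (M.D⁻¹ + M.Zstarᵀ * M.Sigma⁻¹ * M.Zstar)⁻¹

/-- The skewness vector `Ψ*^{-1/2} Z* D ζ / √(1 + ζᵀ Λ* ζ)` of the stacked vector. -/
def lamBar : Fin m ⊕ Fin r → ℝ :=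
  (√(1 + M.zeta ⬝ᵥ (M.Lambda *ᵥ M.zeta)))⁻¹ •
    (CFC.sqrt M.Psi⁻¹ *ᵥ (M.Zstar *ᵥ (M.D *ᵥ M.zeta)))

/-- `Ψ*₁₁`. -/
def Psi11 : Matrix (Fin m) (Fin m) ℝ := M.Psi.toBlocks₁₁
/-- `Ψ*₁₂`. -/
def Psi12 : Matrix (Fin m) (Fin r) ℝ := M.Psi.toBlocks₁₂
/-- `Ψ*₂₁`. -/
def Psi21 : Matrix (Fin r) (Fin m) ℝ := M.Psi.toBlocks₂₁
/-- `Ψ*₂₂`. -/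
def Psi22 : Matrix (Fin r) (Fin r) ℝ := M.Psi.toBlocks₂₂

/-- `Ψ*₂₂.₁ = Ψ*₂₂ - Ψ*₂₁ Ψ*₁₁⁻¹ Ψ*₁₂`. -/
def Psi22_1 : Matrix (Fin r) (Fin r) ℝ := M.Psi22 - M.Psi21 * M.Psi11⁻¹ * M.Psi12

/-- `υ = Ψ*^{-1/2} lamBar`. -/
def upsilon : Fin m ⊕ Fin r → ℝ := CFC.sqrt M.Psi⁻¹ *ᵥ M.lamBar
/-- `υ⁽¹⁾`. -/
def upsilon1 : Fin m → ℝ := fun j => M.upsilon (Sum.inl j)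
/-- `υ⁽²⁾`. -/
def upsilon2 : Fin r → ℝ := fun j => M.upsilon (Sum.inr j)

/-- `√(1 + υ⁽²⁾ᵀ Ψ*₂₂.₁ υ⁽²⁾)`. -/
def scale : ℝ := √(1 + M.upsilon2 ⬝ᵥ (M.Psi22_1 *ᵥ M.upsilon2))

/-- `υ̃ = (υ⁽¹⁾ + Ψ*₁₁⁻¹ Ψ*₁₂ υ⁽²⁾) / √(1 + υ⁽²⁾ᵀ Ψ*₂₂.₁ υ⁽²⁾)`. -/
def upsilonTilde : Fin m → ℝ :=
  M.scale⁻¹ • (M.upsilon1 + M.Psi11⁻¹ *ᵥ (M.Psi12 *ᵥ M.upsilon2))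

/-- The centred observation `y - X β - c Z Δ`. -/
def resid (y : Fin m → ℝ) : Fin m → ℝ := y - M.X *ᵥ M.beta - M.c • (M.Z *ᵥ M.Delta)

/-- `μ₂.₁ = X⁺ β + c Z⁺ Δ + Ψ*₂₁ Ψ*₁₁⁻¹ (y - X β - c Z Δ)`. -/
def mu2_1 (y : Fin m → ℝ) : Fin r → ℝ :=
  M.Xp *ᵥ M.beta + M.c • (M.Zp *ᵥ M.Delta) + M.Psi21 *ᵥ (M.Psi11⁻¹ *ᵥ M.resid y)

/-- `u^{-1/2} W_Φ(u^{1/2} υ̃ᵀ (y - X β - c Z Δ))`. -/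
def tauIntegrand (y : Fin m → ℝ) (u : ℝ) : ℝ :=
  (√u)⁻¹ * WPhi (√u * (M.upsilonTilde ⬝ᵥ M.resid y))

/-- `τ̃₋₁(y) = E[U^{-1/2} W_Φ(U^{1/2} υ̃ᵀ (Y - X β - c Z Δ)) | Y = y]`. -/
def tauTilde {Ω : Type*} [MeasurableSpace Ω] (P : Measure Ω) [IsFiniteMeasure P]
    (Y : Ω → Fin m → ℝ) (U : Ω → ℝ) (y : Fin m → ℝ) : ℝ :=
  ∫ u, M.tauIntegrand y u ∂(condDistrib U Y P y)

/-- The predictor `μ₂.₁ + τ̃₋₁ Ψ*₂₂.₁ υ⁽²⁾ / √(1 + υ⁽²⁾ᵀ Ψ*₂₂.₁ υ⁽²⁾)` at the observation `y`. -/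
def predictor {Ω : Type*} [MeasurableSpace Ω] (P : Measure Ω) [IsFiniteMeasure P]
    (Y : Ω → Fin m → ℝ) (U : Ω → ℝ) (y : Fin m → ℝ) : Fin r → ℝ :=
  M.mu2_1 y + (M.tauTilde P Y U y / M.scale) • (M.Psi22_1 *ᵥ M.upsilon2)

end Model

/-- The mean squared (Euclidean) error `E ‖V - W‖²` of `W` as a predictor of `V`. -/
def mse {Ω : Type*} [MeasurableSpace Ω] (P : Measure Ω) {r : ℕ} (V W : Ω → Fin r → ℝ) : ℝ≥0∞ :=
  ∫⁻ ω, ENNReal.ofReal (∑ j, (V ω j - W ω j) ^ 2) ∂P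

/-- `f(T)` has minimum mean squared error among all predictors `g(T)` of `V` from the data `T`,
and every predictor `g(T)` of finite mean squared error that does as well agrees with it almost
surely. -/
structure IsMinMSEPredictor {Ω 𝓣 : Type*} [MeasurableSpace Ω] [MeasurableSpace 𝓣] (P : Measure Ω)
    {r : ℕ} (V : Ω → Fin r → ℝ) (T : Ω → 𝓣) (f : 𝓣 → Fin r → ℝ) : Prop where
  measurable : Measurable f
  le : ∀ g : 𝓣 → Fin r → ℝ, Measurable g →
    mse P V (fun ω => f (T ω)) ≤ mse P V (fun ω => g (T ω))
  unique : ∀ g : 𝓣 → Fin r → ℝ, Measurable g → mse P V (fun ω => g (T ω)) ≠ ∞ →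
    mse P V (fun ω => g (T ω)) ≤ mse P V (fun ω => f (T ω)) →
    ∀ᵐ ω ∂P, g (T ω) = f (T ω)

end SMSN

end

/-! Factor `M.Psi` as A Aᵀ with A block lower triangular, with diagonal blocks L₁, L₂ and lower left
block Ψ₂₁Ψ₁₁⁻¹L₁. Given U = u, the stacked vector is its location plus u^{-1/2} A x, where x = (x₁,
x₂) has density 2Φ(a₁ᵀx₁ + a₂ᵀx₂) with respect to the standard normal law and a = Aᵀυ. The factor
u^{1/2} inside Φ cancels the scaling u^{-1/2}, so this density is free of u: the law of (U, Y, Y⁺)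
is an image of the product of H with one fixed skew normal law (`exists_map_eq_map_stack`).

In these coordinates Y⁺ - μ₂.₁(Y) = u^{-1/2} L₂x₂, and Y is a bijective function of x₁ for fixed u.
So only the mean of x₂ given x₁ is needed. With s = √(1 + a₂ᵀa₂), two Gaussian integrals give ∫
Φ(a₁ᵀx₁ + a₂ᵀx₂) = Φ(a₁ᵀx₁/s) and ∫ x₂ Φ(a₁ᵀx₁ + a₂ᵀx₂) = (a₂/s) φ₁(a₁ᵀx₁/s), the integrals being
over standard normal x₂ (`integral_Phi_add_dotProduct`, `integral_eval_mul_Phi_add_dotProduct`).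
Their quotient is the mean (a₂/s) W_Φ(a₁ᵀx₁/s) (`setIntegral_stdSkewNormal_eq_zero`). Since L₂a₂ =
Ψ₂₂.₁υ⁽²⁾, s = `M.scale` and a₁ᵀx₁/s = u^{1/2} υ̃ᵀ(Y - Xβ - cZΔ), this is the correction term before
U is averaged out. Averaging over U given Y turns it into τ̃₋₁ (`condExp_eq_predictor`). Finiteness
of k₁ makes u^{-1/2} integrable, which supplies all first moments.

Optimality is the Pythagorean identity for conditional means (`isMinMSEPredictor_of_condExp`),
arranged so that Y⁺ itself need not be square integrable. Independent observations leave the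
conditional mean unchanged (`condExp_prodMk_of_indepFun`). -/

namespace SMSN

/-! ### Moments of the standard normal law and facts about Φ -/

section Stein

variable {ι : Type*} [Fintype ι]

/-- The standard normal distribution on `ι → ℝ`. -/
noncomputable def stdNormal (ι : Type*) [Fintype ι] : Measure (ι → ℝ) := Measure.pi fun _ => gaussianReal 0 1

instance : IsProbabilityMeasure (stdNormal ι) := by unfold stdNormal; infer_instance

theorem stdNormal_map_eval (i : ι) : (stdNormal ι).map (fun x => x i) = gaussianReal 0 1 :=
  (measurePreserving_eval (fun _ : ι => gaussianReal 0 1) i).map_eq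

theorem iIndepFun_stdNormal : iIndepFun (fun (i : ι) (x : ι → ℝ) => x i) (stdNormal ι) :=
  iIndepFun_pi (X := fun (_ : ι) (t : ℝ) => t) (fun _ => measurable_id.aemeasurable)

theorem hasGaussianLaw_eval_stdNormal (i : ι) :
    HasGaussianLaw (fun x : ι → ℝ => x i) (stdNormal ι) :=
  ⟨by rw [stdNormal_map_eval]; infer_instance⟩

instance isGaussian_stdNormal : IsGaussian (stdNormal ι) := by
  have h := (iIndepFun_stdNormal (ι := ι)).hasGaussianLaw hasGaussianLaw_eval_stdNormal
  simpa using h.isGaussian_map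

theorem memLp_eval_stdNormal (i : ι) : MemLp (fun x : ι → ℝ => x i) 2 (stdNormal ι) :=
  (hasGaussianLaw_eval_stdNormal i).memLp_two

theorem integral_eval_stdNormal (i : ι) : ∫ x, x i ∂(stdNormal ι) = 0 := by
  rw [← integral_map (φ := fun x : ι → ℝ => x i) (f := fun t => t)
    (measurable_pi_apply i).aemeasurable aestronglyMeasurable_id, stdNormal_map_eval]
  exact integral_id_gaussianReal

theorem covariance_eval_stdNormal [DecidableEq ι] (i j : ι) :
    cov[fun x : ι → ℝ => x i, fun x => x j; stdNormal ι] = if i = j then 1 else 0 := by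
  split_ifs with h
  · subst h
    rw [covariance_self (measurable_pi_apply i).aemeasurable]
    have h1 := variance_map (μ := stdNormal ι) (X := fun t : ℝ => t) (Y := fun x : ι → ℝ => x i)
      (by fun_prop) (measurable_pi_apply i).aemeasurable
    rw [stdNormal_map_eval, variance_fun_id_gaussianReal] at h1
    exact h1.symm
  · exact (iIndepFun_stdNormal.indepFun h).covariance_eq_zero (memLp_eval_stdNormal i)
      (memLp_eval_stdNormal j)

theorem memLp_dotProduct_stdNormal (b : ι → ℝ) :
    MemLp (fun x : ι → ℝ => b ⬝ᵥ x) 2 (stdNormal ι) :=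
  memLp_finsetSum _ fun i _ => (memLp_eval_stdNormal i).const_mul (b i)

theorem covariance_eval_dotProduct_stdNormal (b : ι → ℝ) (k : ι) :
    cov[fun x : ι → ℝ => x k, fun x => b ⬝ᵥ x; stdNormal ι] = b k := by
  classical
  simp only [dotProduct]
  rw [covariance_fun_sum_right (fun i => (memLp_eval_stdNormal i).const_mul (b i))
    (memLp_eval_stdNormal k)]
  simp [covariance_const_mul_right, covariance_eval_stdNormal]

theorem variance_dotProduct_stdNormal (b : ι → ℝ) :
    Var[fun x : ι → ℝ => b ⬝ᵥ x; stdNormal ι] = b ⬝ᵥ b := by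
  rw [← covariance_self (memLp_dotProduct_stdNormal b).aestronglyMeasurable.aemeasurable]
  nth_rewrite 1 [show (fun x : ι → ℝ => b ⬝ᵥ x) = fun x => ∑ i, b i * x i from rfl]
  rw [covariance_fun_sum_left (fun i => (memLp_eval_stdNormal i).const_mul (b i))
    (memLp_dotProduct_stdNormal b)]
  simp only [covariance_const_mul_left, covariance_eval_dotProduct_stdNormal]
  rfl

theorem integral_dotProduct_stdNormal (b : ι → ℝ) : ∫ x, b ⬝ᵥ x ∂(stdNormal ι) = 0 := by
  simp only [dotProduct]
  rw [integral_finsetSum _ fun i _ =>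
    ((memLp_eval_stdNormal i).const_mul (b i)).integrable one_le_two]
  simp [integral_const_mul, integral_eval_stdNormal]

theorem Phi_eq (t : ℝ) : Phi t = (gaussianReal 0 1).real (Set.Iic t) := cdf_eq_real _ _

theorem Phi_nonneg (t : ℝ) : 0 ≤ Phi t := cdf_nonneg _ _

theorem Phi_le_one (t : ℝ) : Phi t ≤ 1 := cdf_le_one _ _

/-- Lebesgue measure is absolutely continuous with respect to the normal law, so a half-line that is
null for the latter would be Lebesgue null. -/
theorem Phi_pos (t : ℝ) : 0 < Phi t := by
  rw [Phi_eq, measureReal_def]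
  refine ENNReal.toReal_pos (fun h => ?_) (measure_ne_top _ _)
  have := gaussianReal_absolutelyContinuous' 0 one_ne_zero h
  simp at this

/-- `∫_{(-∞, t]} x φ₁(x) dx = -φ₁(t)`. -/
theorem setIntegral_Iic_id_gaussianReal (t : ℝ) :
    ∫ x in Set.Iic t, x ∂(gaussianReal 0 1) = -gaussianPDFReal 0 1 t := by
  have hder : ∀ x : ℝ, HasDerivAt (fun x => -gaussianPDFReal 0 1 x)
      (gaussianPDFReal 0 1 x * x) x := by
    intro x
    unfold gaussianPDFReal
    have h : HasDerivAt (fun x : ℝ => -(x - 0) ^ 2 / (2 * ((1 : NNReal) : ℝ))) (-x) x := by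
      have := ((((hasDerivAt_id x).sub_const 0).pow 2).neg).div_const (2 * ((1 : NNReal) : ℝ))
      refine this.congr_deriv ?_
      simp; ring
    refine ((h.exp.const_mul _).neg).congr_deriv ?_
    ring
  have hint : Integrable (fun x : ℝ => gaussianPDFReal 0 1 x * x) := by
    have h := (memLp_id_gaussianReal (μ := 0) (v := 1) 1).integrable le_rfl
    rw [gaussianReal_of_var_ne_zero 0 one_ne_zero,
      integrable_withDensity_iff_integrable_smul' (measurable_gaussianPDF _ _)
      (by simp [gaussianPDF_lt_top])] at h
    simpa [toReal_gaussianPDF] using h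
  have htend : Filter.Tendsto (fun x => -gaussianPDFReal 0 1 x) Filter.atBot (nhds 0) := by
    have h1 : Filter.Tendsto (fun x : ℝ => -(x - 0) ^ 2 / (2 * ((1 : NNReal) : ℝ)))
        Filter.atBot Filter.atBot := by
      -- For x ≤ -2 the exponent satisfies -x²/2 ≤ x, which explains the threshold.
      refine Filter.tendsto_atBot_mono' _ ?_ Filter.tendsto_id
      filter_upwards [Filter.eventually_le_atBot (-2)] with x hx
      simp only [sub_zero, NNReal.coe_one, id]
      nlinarith
    have h2 := ((Real.tendsto_exp_atBot.comp h1).const_mul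
      (√(2 * Real.pi * ((1 : NNReal) : ℝ)))⁻¹).neg
    rw [mul_zero, neg_zero] at h2
    exact h2
  rw [gaussianReal_of_var_ne_zero 0 one_ne_zero,
    setIntegral_withDensity_eq_setIntegral_toReal_smul (measurable_gaussianPDF _ _)
      (by simp [gaussianPDF_lt_top]) _ measurableSet_Iic]
  simp only [toReal_gaussianPDF, smul_eq_mul]
  rw [integral_Iic_of_hasDerivAt_of_tendsto' (fun x _ => hder x) hint.integrableOn htend, sub_zero]


/-! ### Gaussian integrals of Φ(t + bᵀX), through V = Z - bᵀX with Z an independent standard normal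
variable -/

section ProbitIntegrals

variable (b : ι → ℝ)

theorem memLp_snd_sub_dotProduct : MemLp (fun p : (ι → ℝ) × ℝ => p.2 - b ⬝ᵥ p.1) 2
    ((stdNormal ι).prod (gaussianReal 0 1)) :=
  (((memLp_id_gaussianReal (μ := 0) (v := 1) 2).comp_snd (stdNormal ι))).sub
    ((memLp_dotProduct_stdNormal b).comp_fst (gaussianReal 0 1))

theorem integral_snd_sub_dotProduct :
    ∫ p : (ι → ℝ) × ℝ, (p.2 - b ⬝ᵥ p.1) ∂((stdNormal ι).prod (gaussianReal 0 1)) = 0 := by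
  rw [integral_sub]
  · rw [integral_fun_snd (fun t : ℝ => t), integral_fun_fst (fun x : ι → ℝ => b ⬝ᵥ x),
      integral_dotProduct_stdNormal, integral_id_gaussianReal]
    simp
  · exact ((memLp_id_gaussianReal (μ := 0) (v := 1) 2).comp_snd (stdNormal ι)).integrable
      one_le_two
  · exact ((memLp_dotProduct_stdNormal b).comp_fst (gaussianReal 0 1)).integrable one_le_two

theorem variance_snd_sub_dotProduct :
    Var[fun p : (ι → ℝ) × ℝ => p.2 - b ⬝ᵥ p.1; (stdNormal ι).prod (gaussianReal 0 1)]
      = 1 + b ⬝ᵥ b := by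
  have h1 : MemLp (fun t : ℝ => t) 2 (gaussianReal 0 1) := memLp_id_gaussianReal 2
  have h2 := memLp_dotProduct_stdNormal b
  have hc : cov[fun p : (ι → ℝ) × ℝ => p.2, fun p => b ⬝ᵥ p.1;
      (stdNormal ι).prod (gaussianReal 0 1)] = 0 := by
    rw [covariance_comm]
    exact covariance_fst_snd_prod h2 h1
  have hv1 : Var[fun p : (ι → ℝ) × ℝ => p.2; (stdNormal ι).prod (gaussianReal 0 1)] = 1 := by
    have := variance_map (μ := (stdNormal ι).prod (gaussianReal 0 1)) (X := fun t : ℝ => t)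
      (Y := Prod.snd) (by fun_prop) (by fun_prop)
    rw [Measure.map_snd_prod, measure_univ, one_smul, variance_fun_id_gaussianReal] at this
    exact this.symm
  have hv2 : Var[fun p : (ι → ℝ) × ℝ => b ⬝ᵥ p.1; (stdNormal ι).prod (gaussianReal 0 1)]
      = b ⬝ᵥ b := by
    have := variance_map (μ := (stdNormal ι).prod (gaussianReal 0 1))
      (X := fun x : ι → ℝ => b ⬝ᵥ x) (Y := Prod.fst)
      (by rw [Measure.map_fst_prod, measure_univ, one_smul]
          exact h2.aestronglyMeasurable.aemeasurable) (by fun_prop)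
    rw [Measure.map_fst_prod, measure_univ, one_smul, variance_dotProduct_stdNormal] at this
    exact this.symm
  rw [variance_fun_sub (h1.comp_snd (stdNormal ι)) (h2.comp_fst (gaussianReal 0 1))]
  rw [hc, hv1, hv2]
  ring

theorem covariance_eval_snd_sub_dotProduct (k : ι) :
    cov[fun p : (ι → ℝ) × ℝ => p.1 k, fun p => p.2 - b ⬝ᵥ p.1;
      (stdNormal ι).prod (gaussianReal 0 1)] = -b k := by
  have h1 : MemLp (fun t : ℝ => t) 2 (gaussianReal 0 1) := memLp_id_gaussianReal 2
  have h2 := memLp_dotProduct_stdNormal b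
  have h3 := memLp_eval_stdNormal k
  have hc : cov[fun p : (ι → ℝ) × ℝ => p.1 k, fun p => p.2;
      (stdNormal ι).prod (gaussianReal 0 1)] = 0 := covariance_fst_snd_prod h3 h1
  have hd : cov[fun p : (ι → ℝ) × ℝ => p.1 k, fun p => b ⬝ᵥ p.1;
      (stdNormal ι).prod (gaussianReal 0 1)] = b k := by
    have := covariance_map (μ := (stdNormal ι).prod (gaussianReal 0 1))
      (X := fun x : ι → ℝ => x k) (Y := fun x : ι → ℝ => b ⬝ᵥ x) (Z := Prod.fst)
      (by rw [Measure.map_fst_prod, measure_univ, one_smul]; exact h3.aestronglyMeasurable)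
      (by rw [Measure.map_fst_prod, measure_univ, one_smul]; exact h2.aestronglyMeasurable)
      (by fun_prop)
    rw [Measure.map_fst_prod, measure_univ, one_smul,
      covariance_eval_dotProduct_stdNormal] at this
    exact this.symm
  rw [covariance_fun_sub_right (h3.comp_fst _) (h1.comp_snd (stdNormal ι))
    (h2.comp_fst (gaussianReal 0 1))]
  rw [hc, hd, zero_sub]

theorem one_add_dotProduct_self_pos : 0 < 1 + b ⬝ᵥ b := by
  have : 0 ≤ b ⬝ᵥ b := Finset.sum_nonneg fun i _ => mul_self_nonneg (b i)
  linarith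

/-- The pair is a linear image of a Gaussian vector. Joint Gaussianity is what later turns zero
covariance into independence. -/
theorem hasGaussianLaw_eval_add_snd_sub (k : ι) (c : ℝ) :
    HasGaussianLaw (fun p : (ι → ℝ) × ℝ =>
      (p.1 k + c * (p.2 - b ⬝ᵥ p.1), p.2 - b ⬝ᵥ p.1))
      ((stdNormal ι).prod (gaussianReal 0 1)) := by
  let F : (ι → ℝ) × ℝ →ₗ[ℝ] ℝ := LinearMap.snd ℝ _ _ -
    (∑ i, b i • LinearMap.proj i) ∘ₗ LinearMap.fst ℝ (ι → ℝ) ℝ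
  let G : (ι → ℝ) × ℝ →ₗ[ℝ] ℝ × ℝ :=
    ((LinearMap.proj k ∘ₗ LinearMap.fst ℝ (ι → ℝ) ℝ) + c • F).prod F
  have h := (IsGaussian.hasGaussianLaw_id (μ := (stdNormal ι).prod (gaussianReal 0 1))).map_fun
    (LinearMap.toContinuousLinearMap G)
  refine h.congr (Filter.Eventually.of_forall fun p => ?_)
  simp [F, G, dotProduct]

theorem map_snd_sub_dotProduct :
    ((stdNormal ι).prod (gaussianReal 0 1)).map (fun p : (ι → ℝ) × ℝ => p.2 - b ⬝ᵥ p.1) =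
      (gaussianReal 0 1).map (fun x => √(1 + b ⬝ᵥ b) * x) := by
  let F : (ι → ℝ) × ℝ →ₗ[ℝ] ℝ := LinearMap.snd ℝ _ _ -
    (∑ i, b i • LinearMap.proj i) ∘ₗ LinearMap.fst ℝ (ι → ℝ) ℝ
  have h := ((IsGaussian.hasGaussianLaw_id
    (μ := (stdNormal ι).prod (gaussianReal 0 1))).map_fun
    (LinearMap.toContinuousLinearMap F)).congr
    (Y := fun p : (ι → ℝ) × ℝ => p.2 - b ⬝ᵥ p.1)
    (Filter.Eventually.of_forall fun p => by simp [F, dotProduct])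
  rw [h.map_eq_gaussianReal, integral_snd_sub_dotProduct, variance_snd_sub_dotProduct,
    gaussianReal_map_const_mul]
  congr 1
  · simp
  · ext
    simp [Real.sq_sqrt (one_add_dotProduct_self_pos b).le,
      (one_add_dotProduct_self_pos b).le]

theorem measurable_snd_sub_dotProduct :
    Measurable (fun p : (ι → ℝ) × ℝ => p.2 - b ⬝ᵥ p.1) := by
  simp only [dotProduct]
  fun_prop

/-- Φ(t + bᵀx) is the probability that Z ≤ t + bᵀx, so Fubini replaces the factor Φ by the event V ≤
t. -/
theorem integral_mul_Phi_eq {h : (ι → ℝ) → ℝ} (hh : Integrable h (stdNormal ι)) (t : ℝ) :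
    ∫ x, h x * Phi (t + b ⬝ᵥ x) ∂(stdNormal ι) =
      ∫ p in {p : (ι → ℝ) × ℝ | p.2 - b ⬝ᵥ p.1 ≤ t}, h p.1
        ∂((stdNormal ι).prod (gaussianReal 0 1)) := by
  have hm : MeasurableSet {p : (ι → ℝ) × ℝ | p.2 - b ⬝ᵥ p.1 ≤ t} :=
    measurableSet_le (measurable_snd_sub_dotProduct b) measurable_const
  rw [← integral_indicator hm, integral_prod _ ((hh.comp_fst _).indicator hm)]
  refine integral_congr_ae (Filter.Eventually.of_forall fun x => ?_)
  have : (fun y : ℝ => ({p : (ι → ℝ) × ℝ | p.2 - b ⬝ᵥ p.1 ≤ t}).indicator (fun p => h p.1) (x, y))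
      = (Set.Iic (t + b ⬝ᵥ x)).indicator (fun _ => h x) := by
    ext y
    simp only [Set.indicator, Set.mem_ofPred_eq, Set.mem_Iic, sub_le_iff_le_add]
  simp only [this]
  rw [integral_indicator measurableSet_Iic, setIntegral_const, Phi_eq, smul_eq_mul, mul_comm]

/-- `E Φ(t + bᵀX) = Φ(t / √(1 + bᵀb))` for a standard normal vector `X`. -/
theorem integral_Phi_add_dotProduct (t : ℝ) :
    ∫ x, Phi (t + b ⬝ᵥ x) ∂(stdNormal ι) = Phi (t / √(1 + b ⬝ᵥ b)) := by
  have hs := Real.sqrt_pos.2 (one_add_dotProduct_self_pos b)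
  have h := integral_mul_Phi_eq b (integrable_const (1 : ℝ)) t
  simp only [one_mul] at h
  rw [h, setIntegral_const, smul_eq_mul, mul_one, Phi_eq]
  have h1 := map_measureReal_apply (μ := (stdNormal ι).prod (gaussianReal 0 1))
    (measurable_snd_sub_dotProduct b) (measurableSet_Iic (a := t))
  rw [map_snd_sub_dotProduct, map_measureReal_apply (by fun_prop) measurableSet_Iic] at h1
  refine h1.symm.trans ?_
  congr 1
  ext x
  simp [le_div_iff₀ hs, mul_comm]

/-- `E X_k Φ(t + bᵀX) = b_k φ₁(t / √(1 + bᵀb)) / √(1 + bᵀb)` for a standard normal vector `X`. -/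
theorem integral_eval_mul_Phi_add_dotProduct (t : ℝ) (k : ι) :
    ∫ x, x k * Phi (t + b ⬝ᵥ x) ∂(stdNormal ι) =
      b k / √(1 + b ⬝ᵥ b) * gaussianPDFReal 0 1 (t / √(1 + b ⬝ᵥ b)) := by
  set μ := (stdNormal ι).prod (gaussianReal 0 1) with hμ
  set s := √(1 + b ⬝ᵥ b) with hs_def
  have hpos := one_add_dotProduct_self_pos b
  have hs : 0 < s := Real.sqrt_pos.2 hpos
  have hs2 : s * s = 1 + b ⬝ᵥ b := Real.mul_self_sqrt hpos.le
  -- Minus the regression coefficient of X_k on V: Cov(X_k, V) = -b_k and Var V = 1 + bᵀb, so X_k +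
  -- cV is uncorrelated with V, hence independent of it.
  set c := b k / (1 + b ⬝ᵥ b) with hc
  have hm := measurable_snd_sub_dotProduct b
  have hX : MemLp (fun p : (ι → ℝ) × ℝ => p.1 k) 2 μ := (memLp_eval_stdNormal k).comp_fst _
  have hV := memLp_snd_sub_dotProduct b
  have hXi := hX.integrable one_le_two
  have hVi := hV.integrable one_le_two
  have hset : MeasurableSet {p : (ι → ℝ) × ℝ | p.2 - b ⬝ᵥ p.1 ≤ t} :=
    measurableSet_le hm measurable_const
  rw [integral_mul_Phi_eq b (h := fun x => x k)
    ((memLp_eval_stdNormal k).integrable one_le_two)]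
  have hind : IndepFun (fun p : (ι → ℝ) × ℝ => p.1 k + c * (p.2 - b ⬝ᵥ p.1))
      (fun p => p.2 - b ⬝ᵥ p.1) μ := by
    refine (hasGaussianLaw_eval_add_snd_sub b k c).indepFun_of_covariance_eq_zero ?_
    have hadd := covariance_add_left hX (hV.const_mul c) hV
    rw [covariance_const_mul_left, covariance_eval_snd_sub_dotProduct,
      covariance_self hm.aemeasurable, variance_snd_sub_dotProduct, hc,
      div_mul_cancel₀ _ hpos.ne', neg_add_cancel] at hadd
    exact hadd
  -- A centred variable independent of V integrates to zero over the event V ≤ t. This reduces the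
  -- integral of X_k there to -c times that of V.
  have hzero : ∫ p in {p : (ι → ℝ) × ℝ | p.2 - b ⬝ᵥ p.1 ≤ t},
      (p.1 k + c * (p.2 - b ⬝ᵥ p.1)) ∂μ = 0 := by
    have hmean : ∫ p, (p.1 k + c * (p.2 - b ⬝ᵥ p.1)) ∂μ = 0 := by
      rw [integral_add hXi (hVi.const_mul c), integral_const_mul, integral_snd_sub_dotProduct,
        integral_fun_fst (fun x : ι → ℝ => x k), integral_eval_stdNormal]
      simp
    have hφ : Measurable ((Set.Iic t).indicator (fun _ : ℝ => (1 : ℝ))) :=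
      measurable_const.indicator measurableSet_Iic
    have := (hind.comp measurable_id hφ).integral_mul_eq_mul_integral
      (hXi.add (hVi.const_mul c)).aestronglyMeasurable (hφ.comp hm).aestronglyMeasurable
    rw [show ∫ p, (id ∘ fun p : (ι → ℝ) × ℝ => p.1 k + c * (p.2 - b ⬝ᵥ p.1)) p ∂μ = 0 from hmean,
      zero_mul] at this
    rw [← integral_indicator hset, ← this]
    refine integral_congr_ae (Filter.Eventually.of_forall fun p => ?_)
    simp [Set.indicator]
  have hVint : ∫ p in {p : (ι → ℝ) × ℝ | p.2 - b ⬝ᵥ p.1 ≤ t}, (p.2 - b ⬝ᵥ p.1) ∂μ =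
      s * -gaussianPDFReal 0 1 (t / s) := by
    have h1 := setIntegral_map (μ := μ) (f := fun v : ℝ => v) (measurableSet_Iic (a := t))
      aestronglyMeasurable_id hm.aemeasurable
    rw [map_snd_sub_dotProduct, setIntegral_map (f := fun v : ℝ => v) measurableSet_Iic
      aestronglyMeasurable_id (by fun_prop), integral_const_mul] at h1
    refine h1.symm.trans ?_
    rw [← setIntegral_Iic_id_gaussianReal]
    congr 3
    ext x
    simp [← hs_def, le_div_iff₀ hs, mul_comm]
  rw [integral_add hXi.integrableOn (hVi.const_mul c).integrableOn, integral_const_mul,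
    hVint] at hzero
  rw [eq_neg_of_add_eq_zero_left hzero, hc, ← hs2]
  field_simp

end ProbitIntegrals

end Stein

/-! ### The multivariate normal density as an affine image of the standard normal law -/

section ChangeOfVariables

variable {ι : Type*} [Fintype ι]

/-- A product measure is determined by its values on boxes, and there the integral of the product
density factors. -/
theorem stdNormal_eq_withDensity :
    stdNormal ι = (volume : Measure (ι → ℝ)).withDensity
      (fun x => ∏ i, gaussianPDF 0 1 (x i)) := by
  refine Measure.pi_eq fun s hs => ?_
  rw [withDensity_apply _ (MeasurableSet.univ_pi hs), volume_pi, Measure.restrict_pi_pi]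
  have hi : ∀ i, Integrable (gaussianPDFReal 0 1) ((volume : Measure ℝ).restrict (s i)) :=
    fun i => (integrable_gaussianPDFReal 0 1).restrict
  simp only [gaussianPDF]
  simp_rw [← ENNReal.ofReal_prod_of_nonneg fun i _ => gaussianPDFReal_nonneg 0 1 _]
  rw [← ofReal_integral_eq_lintegral_ofReal (Integrable.fintype_prod hi)
      (Filter.Eventually.of_forall fun x => Finset.prod_nonneg fun i _ =>
        gaussianPDFReal_nonneg _ _ _),
    integral_fintype_prod_eq_prod (fun _ : ι => gaussianPDFReal 0 1),
    ENNReal.ofReal_prod_of_nonneg fun i _ => integral_nonneg fun x => gaussianPDFReal_nonneg _ _ _]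
  exact Finset.prod_congr rfl fun i _ => (gaussianReal_apply_eq_integral 0 one_ne_zero (s i)).symm

variable [DecidableEq ι]

/-- With y = mu + Ax the quadratic form of (A Aᵀ)⁻¹ becomes xᵀx, and √det(A Aᵀ) = |det A| is the
Jacobian. -/
theorem prod_gaussianPDF_eq (A : Matrix ι ι ℝ) (hA : A.det ≠ 0) (mu x : ι → ℝ) :
    ∏ i, gaussianPDF 0 1 (x i) =
      ENNReal.ofReal |A.det| * ENNReal.ofReal (normalPDF mu (A * Aᵀ) (mu + A *ᵥ x)) := by
  have hq : (A *ᵥ x) ⬝ᵥ ((A * Aᵀ)⁻¹ *ᵥ (A *ᵥ x)) = x ⬝ᵥ x := by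
    have hu : IsUnit A.det := isUnit_iff_ne_zero.2 hA
    rw [Matrix.mul_inv_rev, ← mulVec_mulVec, mulVec_mulVec x A⁻¹ A, nonsing_inv_mul A hu, one_mulVec,
      dotProduct_mulVec, ← transpose_nonsing_inv, vecMul_transpose, mulVec_mulVec,
      nonsing_inv_mul A hu, one_mulVec]
  have hpow : √((2 * Real.pi) ^ Fintype.card ι) = √(2 * Real.pi) ^ Fintype.card ι := by
    rw [Real.sqrt_eq_iff_mul_self_eq (by positivity) (by positivity), ← mul_pow,
      Real.mul_self_sqrt (by positivity)]
  have hd : √((2 * Real.pi) ^ Fintype.card ι * (A * Aᵀ).det)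
      = √(2 * Real.pi) ^ Fintype.card ι * |A.det| := by
    rw [det_mul, det_transpose, Real.sqrt_mul (by positivity), Real.sqrt_mul_self_eq_abs,
      hpow]
  simp only [gaussianPDF]
  rw [← ENNReal.ofReal_prod_of_nonneg fun i _ => gaussianPDFReal_nonneg _ _ _,
    ← ENNReal.ofReal_mul (abs_nonneg _), normalPDF, add_sub_cancel_left, hq, hd]
  congr 1
  simp only [gaussianPDFReal, Finset.prod_mul_distrib, ← Real.exp_sum, Finset.prod_const,
    Finset.card_univ, NNReal.coe_one, mul_one, sub_zero]
  have h1 : ∑ i, -x i ^ 2 / 2 = -(x ⬝ᵥ x) / 2 := by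
    rw [← Finset.sum_div, Finset.sum_neg_distrib]
    simp [dotProduct, sq]
  have : |A.det| ≠ 0 := abs_ne_zero.2 hA
  rw [h1, inv_pow]
  field_simp

/-- If `S = A Aᵀ`, integrals against the normal density with covariance `S` are expectations of
functions of `mu + A X` for a standard normal vector `X`. -/
theorem lintegral_normalPDF_mul {A S : Matrix ι ι ℝ} (hA : A.det ≠ 0) (hS : A * Aᵀ = S)
    (mu : ι → ℝ) {f : (ι → ℝ) → ℝ≥0∞} (hf : Measurable f)
    (hn : Measurable (normalPDF mu S)) :
    ∫⁻ y, ENNReal.ofReal (normalPDF mu S y) * f y =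
      ∫⁻ x, f (mu + A *ᵥ x) ∂(stdNormal ι) := by
  subst hS
  have hAm : Measurable (toLin' A) := (LinearMap.continuous_on_pi _).measurable
  have hg : Measurable (fun y => ENNReal.ofReal (normalPDF mu (A * Aᵀ) y) * f y) :=
    hn.ennreal_ofReal.mul hf
  have hvol : (volume : Measure (ι → ℝ)) =
      ENNReal.ofReal |A.det| • (volume : Measure (ι → ℝ)).map (toLin' A) := by
    rw [Real.map_matrix_volume_pi_eq_smul_volume_pi hA, smul_smul, ← ENNReal.ofReal_mul
      (abs_nonneg _), ← abs_mul, mul_inv_cancel₀ hA]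
    simp
  have hpdf : Measurable (fun x : ι → ℝ => ∏ i, gaussianPDF 0 1 (x i)) :=
    Finset.measurable_prod _ fun i _ => (measurable_gaussianPDF 0 1).comp (measurable_pi_apply i)
  have h0 : Measurable (fun x : ι → ℝ => mu + A *ᵥ x) := hAm.const_add mu
  rw [← lintegral_add_left_eq_self _ mu, hvol, lintegral_smul_measure,
    lintegral_map (f := fun x => ENNReal.ofReal (normalPDF mu (A * Aᵀ) (mu + x)) * f (mu + x))
      (hg.comp (measurable_const_add mu)) hAm, stdNormal_eq_withDensity,
    lintegral_withDensity_eq_lintegral_mul _ hpdf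
      (g := fun x => f (mu + A *ᵥ x)) (hf.comp h0),
    smul_eq_mul]
  simp only [toLin'_apply]
  rw [← lintegral_const_mul _
      (f := fun x => ENNReal.ofReal (normalPDF mu (A * Aᵀ) (mu + A *ᵥ x)) * f (mu + A *ᵥ x))
      (hg.comp h0)]
  refine lintegral_congr fun x => ?_
  rw [Pi.mul_apply]
  rw [prod_gaussianPDF_eq A hA mu x, mul_assoc]

end ChangeOfVariables

/-! ### Block Cholesky factorization and the Schur complement -/

section BlockFactor

variable {m r : Type*} [Fintype m] [Fintype r] [DecidableEq m] [DecidableEq r]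

theorem exists_mul_transpose_of_posDef {S : Matrix m m ℝ} (hS : S.PosDef) :
    ∃ L : Matrix m m ℝ, L * Lᵀ = S ∧ L.det ≠ 0 := by
  have hsym : (CFC.sqrt S)ᵀ = CFC.sqrt S := by
    simpa using (nonneg_iff_posSemidef.1 (CFC.sqrt_nonneg S)).1.eq
  have hmul : CFC.sqrt S * CFC.sqrt S = S := CFC.sqrt_mul_sqrt_self S hS.posSemidef.nonneg
  refine ⟨CFC.sqrt S, by rw [hsym, hmul], fun h => ?_⟩
  have := hS.det_pos
  rw [← hmul, det_mul, h, mul_zero] at this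
  exact this.false

/-- The block Cholesky factorization of a positive definite matrix. -/
theorem exists_block_factor {S : Matrix (m ⊕ r) (m ⊕ r) ℝ} (hS : S.PosDef) :
    ∃ (L₁ : Matrix m m ℝ) (L₂ : Matrix r r ℝ), L₁.det ≠ 0 ∧ L₂.det ≠ 0 ∧
      L₂ * L₂ᵀ = S.toBlocks₂₂ - S.toBlocks₂₁ * S.toBlocks₁₁⁻¹ * S.toBlocks₁₂ ∧
      fromBlocks L₁ 0 (S.toBlocks₂₁ * S.toBlocks₁₁⁻¹ * L₁) L₂ *
        (fromBlocks L₁ 0 (S.toBlocks₂₁ * S.toBlocks₁₁⁻¹ * L₁) L₂)ᵀ = S ∧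
      S.toBlocks₁₁ᵀ = S.toBlocks₁₁ ∧ S.toBlocks₂₁ᵀ = S.toBlocks₁₂ := by
  have hsym : Sᵀ = S := by simpa using hS.1.eq
  have h11 : S.toBlocks₁₁.PosDef := hS.submatrix (e := Sum.inl) Sum.inl_injective
  have h11s : S.toBlocks₁₁ᵀ = S.toBlocks₁₁ := by simpa using h11.1.eq
  have h21 : S.toBlocks₂₁ᵀ = S.toBlocks₁₂ := by
    ext i j
    exact congrFun (congrFun hsym (Sum.inl i)) (Sum.inr j)
  have hu : IsUnit S.toBlocks₁₁.det := isUnit_iff_ne_zero.2 h11.det_pos.ne'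
  let := invertibleOfIsUnitDet _ hu
  have hsc : (S.toBlocks₂₂ - S.toBlocks₂₁ * S.toBlocks₁₁⁻¹ * S.toBlocks₁₂).PosDef := by
    have hB : S.toBlocks₂₁ = S.toBlocks₁₂ᴴ := by
      rw [← h21, conjTranspose_eq_transpose_of_trivial, transpose_transpose]
    -- The block criterion gives only semidefiniteness of the Schur complement. Definiteness follows
    -- because det S is the product of the determinants of S₁₁ and of the complement.
    have hps := hS.posSemidef
    rw [← fromBlocks_toBlocks S, hB, PosDef.fromBlocks₁₁ _ _ h11, ← hB] at hps
    rw [hps.posDef_iff_det_ne_zero]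
    have hdet := det_fromBlocks₁₁ S.toBlocks₁₁ S.toBlocks₁₂ S.toBlocks₂₁ S.toBlocks₂₂
    rw [fromBlocks_toBlocks, invOf_eq_nonsing_inv] at hdet
    intro h
    rw [h, mul_zero] at hdet
    exact hS.det_pos.ne' hdet
  obtain ⟨L₁, hL₁, hd₁⟩ := exists_mul_transpose_of_posDef h11
  obtain ⟨L₂, hL₂, hd₂⟩ := exists_mul_transpose_of_posDef hsc
  refine ⟨L₁, L₂, hd₁, hd₂, hL₂, ?_, h11s, h21⟩
  conv_rhs => rw [← fromBlocks_toBlocks S]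
  rw [fromBlocks_transpose, fromBlocks_multiply]
  have e1 : L₁ * (S.toBlocks₂₁ * S.toBlocks₁₁⁻¹ * L₁)ᵀ = S.toBlocks₁₂ := by
    rw [transpose_mul, ← Matrix.mul_assoc, hL₁, transpose_mul, transpose_nonsing_inv, h11s, h21,
      mul_nonsing_inv_cancel_left _ _ hu]
  congr 1
  · simp [hL₁]
  · rw [e1, Matrix.zero_mul, add_zero]
  · simp only [transpose_zero, Matrix.mul_zero, add_zero]
    rw [Matrix.mul_assoc, hL₁, nonsing_inv_mul_cancel_right _ _ hu]
  · rw [Matrix.mul_assoc _ L₁, e1, hL₂, add_sub_cancel]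

end BlockFactor

/-! ### Conditional means as optimal predictors -/

section MeanSquaredError

variable {Ω 𝓣 : Type*} [mΩ : MeasurableSpace Ω] [m𝓣 : MeasurableSpace 𝓣] {P : Measure Ω}
  {r : ℕ}

/-- The Pythagorean identity for the conditional mean of a variable. -/
theorem integral_sq_sub_eq [IsProbabilityMeasure P] {V : Ω → ℝ} {T : Ω → 𝓣} (hT : Measurable T) {f g : 𝓣 → ℝ}
    (hf : Measurable f) (hg : Measurable g)
    (hc : P[V | m𝓣.comap T] =ᵐ[P] fun ω => f (T ω)) (hV : Integrable V P)
    (h2 : MemLp (fun ω => V ω - g (T ω)) 2 P) :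
    MemLp (fun ω => V ω - f (T ω)) 2 P ∧ MemLp (fun ω => g (T ω) - f (T ω)) 2 P ∧
      ∫ ω, (V ω - g (T ω)) ^ 2 ∂P =
        ∫ ω, (V ω - f (T ω)) ^ 2 ∂P + ∫ ω, (g (T ω) - f (T ω)) ^ 2 ∂P := by
  have hle := hT.comap_le
  have hTm : Measurable[m𝓣.comap T] T := comap_measurable T
  have hgi : Integrable (fun ω => g (T ω)) P := by
    have := hV.sub (h2.integrable one_le_two)
    refine this.congr (Filter.Eventually.of_forall fun ω => ?_)
    simp
  have hE : P[fun ω => V ω - g (T ω) | m𝓣.comap T] =ᵐ[P] fun ω => f (T ω) - g (T ω) := by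
    refine (condExp_sub hV hgi _).trans ?_
    rw [condExp_of_stronglyMeasurable (f := fun ω => g (T ω)) hle (hg.comp hTm).stronglyMeasurable hgi]
    filter_upwards [hc] with ω hω
    simp [hω]
  -- V, f(T) and g(T) need not be square integrable separately. The difference f(T) - g(T) is the
  -- conditional mean of V - g(T), and conditioning preserves L².
  have hE2 : MemLp (fun ω => f (T ω) - g (T ω)) 2 P :=
    (h2.condExp one_le_two).ae_eq hE
  have hD2 : MemLp (fun ω => V ω - f (T ω)) 2 P := by
    refine (h2.sub hE2).ae_eq (Filter.Eventually.of_forall fun ω => ?_)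
    simp
  have hE2' : MemLp (fun ω => g (T ω) - f (T ω)) 2 P := by
    refine hE2.neg.ae_eq (Filter.Eventually.of_forall fun ω => ?_)
    simp
  refine ⟨hD2, hE2', ?_⟩
  -- Orthogonality: f(T) - g(T) is a function of T, so it can be pulled out and V - g(T) replaced by
  -- its conditional mean.
  have hmul : ∫ ω, (V ω - g (T ω)) * (f (T ω) - g (T ω)) ∂P =
      ∫ ω, (f (T ω) - g (T ω)) * (f (T ω) - g (T ω)) ∂P := by
    have hi : Integrable (fun ω => (V ω - g (T ω)) * (f (T ω) - g (T ω))) P :=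
      h2.integrable_mul hE2
    have hpull := condExp_mul_of_stronglyMeasurable_right (m := m𝓣.comap T) (μ := P)
      (f := fun ω => V ω - g (T ω)) (g := fun ω => f (T ω) - g (T ω))
      ((hf.sub hg).comp hTm).stronglyMeasurable hi (h2.integrable one_le_two)
    rw [← integral_condExp hle]
    refine integral_congr_ae (hpull.trans ?_)
    filter_upwards [hE] with ω hω
    simp [hω]
  have h1 : Integrable (fun ω => (V ω - g (T ω)) ^ 2) P := h2.integrable_sq
  have h3 : Integrable (fun ω => (V ω - g (T ω)) * (f (T ω) - g (T ω))) P :=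
    h2.integrable_mul hE2
  have h4 : Integrable (fun ω => (f (T ω) - g (T ω)) * (f (T ω) - g (T ω))) P :=
    hE2.integrable_mul hE2
  have e1 : ∫ ω, (V ω - f (T ω)) ^ 2 ∂P = ∫ ω, (V ω - g (T ω)) ^ 2 ∂P -
      2 * ∫ ω, (V ω - g (T ω)) * (f (T ω) - g (T ω)) ∂P +
      ∫ ω, (f (T ω) - g (T ω)) * (f (T ω) - g (T ω)) ∂P := by
    rw [← integral_const_mul, ← integral_sub h1 (h3.const_mul 2),
      ← integral_add (f := fun ω => (V ω - g (T ω)) ^ 2 - 2 * ((V ω - g (T ω)) *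
        (f (T ω) - g (T ω)))) (h1.sub (h3.const_mul 2)) h4]
    refine integral_congr_ae (Filter.Eventually.of_forall fun ω => ?_)
    simp only
    ring
  have e2 : ∫ ω, (g (T ω) - f (T ω)) ^ 2 ∂P =
      ∫ ω, (f (T ω) - g (T ω)) * (f (T ω) - g (T ω)) ∂P := by
    refine integral_congr_ae (Filter.Eventually.of_forall fun ω => ?_)
    simp only
    ring
  rw [e1, e2, hmul]
  ring

theorem mse_eq_ofReal {V W : Ω → Fin r → ℝ} (h : ∀ j, MemLp (fun ω => V ω j - W ω j) 2 P) :
    mse P V W = ENNReal.ofReal (∑ j, ∫ ω, (V ω j - W ω j) ^ 2 ∂P) := by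
  rw [← integral_finsetSum _ fun j _ => (h j).integrable_sq]
  exact (ofReal_integral_eq_lintegral_ofReal
    (integrable_finsetSum _ fun j _ => (h j).integrable_sq)
    (Filter.Eventually.of_forall fun ω => Finset.sum_nonneg fun j _ => sq_nonneg _)).symm

theorem memLp_two_of_mse_ne_top {V W : Ω → Fin r → ℝ}
    (hm : ∀ j, AEStronglyMeasurable (fun ω => V ω j - W ω j) P) (h : mse P V W ≠ ∞) (j : Fin r) :
    MemLp (fun ω => V ω j - W ω j) 2 P := by
  rw [memLp_two_iff_integrable_sq (hm j)]
  refine ⟨(hm j).pow 2, ?_⟩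
  rw [hasFiniteIntegral_iff_ofReal (Filter.Eventually.of_forall fun ω => sq_nonneg _)]
  refine lt_of_le_of_lt (lintegral_mono fun ω => ENNReal.ofReal_le_ofReal ?_) h.lt_top
  exact Finset.single_le_sum (f := fun j => (V ω j - W ω j) ^ 2) (fun i _ => sq_nonneg _)
    (Finset.mem_univ j)

/-- The conditional mean has minimum mean squared error. -/
theorem isMinMSEPredictor_of_condExp [IsProbabilityMeasure P] {V : Ω → Fin r → ℝ} {T : Ω → 𝓣} {f : 𝓣 → Fin r → ℝ}
    (hT : Measurable T) (hf : Measurable f) (hV : ∀ j, Integrable (fun ω => V ω j) P)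
    (hc : ∀ j, P[fun ω => V ω j | m𝓣.comap T] =ᵐ[P] fun ω => f (T ω) j) :
    IsMinMSEPredictor P V T f := by
  -- A single competitor of finite error already forces the error of f(T) to be finite. Competitors
  -- of infinite error need no argument.
  have key : ∀ g : 𝓣 → Fin r → ℝ, Measurable g → mse P V (fun ω => g (T ω)) ≠ ∞ →
      (∀ j, MemLp (fun ω => g (T ω) j - f (T ω) j) 2 P) ∧
      mse P V (fun ω => f (T ω)) ≠ ∞ ∧
      mse P V (fun ω => g (T ω)) = mse P V (fun ω => f (T ω)) +
        ENNReal.ofReal (∑ j, ∫ ω, (g (T ω) j - f (T ω) j) ^ 2 ∂P) := by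
    intro g hg hfin
    have h2 := memLp_two_of_mse_ne_top (P := P) (V := V) (W := fun ω => g (T ω))
      (fun j => (hV j).aestronglyMeasurable.sub
        (((measurable_pi_apply j).comp hg).comp hT).aestronglyMeasurable) hfin
    have h3 := fun j => integral_sq_sub_eq hT ((measurable_pi_apply j).comp hf)
      ((measurable_pi_apply j).comp hg) (hc j) (hV j) (h2 j)
    have hmf := mse_eq_ofReal (P := P) (V := V) (W := fun ω => f (T ω)) fun j => (h3 j).1
    refine ⟨fun j => (h3 j).2.1, by rw [hmf]; exact ENNReal.ofReal_ne_top, ?_⟩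
    rw [hmf, mse_eq_ofReal h2, ← ENNReal.ofReal_add
      (Finset.sum_nonneg fun j _ => integral_nonneg fun ω => sq_nonneg _)
      (Finset.sum_nonneg fun j _ => integral_nonneg fun ω => sq_nonneg _),
      ← Finset.sum_add_distrib]
    exact congrArg _ (Finset.sum_congr rfl fun j _ => (h3 j).2.2)
  refine ⟨hf, fun g hg => ?_, fun g hg hfin hle => ?_⟩
  · by_cases h : mse P V (fun ω => g (T ω)) = ∞
    · rw [h]; exact le_top
    · rw [(key g hg h).2.2]; exact le_self_add
  · obtain ⟨hL, hne, heq⟩ := key g hg hfin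
    rw [heq] at hle
    have h0 : ENNReal.ofReal (∑ j, ∫ ω, (g (T ω) j - f (T ω) j) ^ 2 ∂P) = 0 := by
      by_contra hn
      exact (ENNReal.lt_add_right hne hn).not_ge hle
    have hnn : ∀ j ∈ Finset.univ, 0 ≤ ∫ ω, (g (T ω) j - f (T ω) j) ^ 2 ∂P :=
      fun j _ => integral_nonneg fun ω => sq_nonneg _
    have hs := (Finset.sum_eq_zero_iff_of_nonneg hnn).1
      (le_antisymm (ENNReal.ofReal_eq_zero.1 h0) (Finset.sum_nonneg hnn))
    have hae : ∀ j, ∀ᵐ ω ∂P, g (T ω) j = f (T ω) j := by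
      intro j
      have := (integral_eq_zero_iff_of_nonneg (fun ω => sq_nonneg _) (hL j).integrable_sq).1
        (hs j (Finset.mem_univ j))
      filter_upwards [this] with ω hω
      exact sub_eq_zero.1 (pow_eq_zero_iff two_ne_zero |>.1 hω)
    filter_upwards [ae_all_iff.2 hae] with ω hω
    exact funext hω

/-- Observations that are independent of `(Y, V)` do not change the conditional mean of `V`. -/
theorem condExp_prodMk_of_indepFun [IsProbabilityMeasure P] {𝓨 𝓞 𝓥 : Type*} [m𝓨 : MeasurableSpace 𝓨]
    [m𝓞 : MeasurableSpace 𝓞] [MeasurableSpace 𝓥]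
    {Y : Ω → 𝓨} {W : Ω → 𝓥} {O : Ω → 𝓞} (hY : Measurable Y) (hW : Measurable W)
    (hO : Measurable O) (hind : IndepFun (fun ω => (Y ω, W ω)) O P)
    {v : 𝓥 → ℝ} (hv : Measurable v) (hV : Integrable (fun ω => v (W ω)) P)
    {f : 𝓨 → ℝ} (hf : Measurable f)
    (hc : P[fun ω => v (W ω) | m𝓨.comap Y] =ᵐ[P] fun ω => f (Y ω)) :
    P[fun ω => v (W ω) | (m𝓨.prod m𝓞).comap (fun ω => (Y ω, O ω))] =ᵐ[P] fun ω => f (Y ω) := by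
  have hYO : Measurable (fun ω => (Y ω, O ω)) := hY.prodMk hO
  have hfi : Integrable (fun ω => f (Y ω)) P := integrable_condExp.congr hc
  -- The defining property of the conditional mean given Y, with the event as an indicator factor so
  -- that it applies to every section of an event of (Y, O).
  have hset : ∀ B : Set 𝓨, MeasurableSet B →
      ∫ ω, B.indicator 1 (Y ω) * f (Y ω) ∂P = ∫ ω, B.indicator 1 (Y ω) * v (W ω) ∂P := by
    intro B hB
    have h := setIntegral_condExp hY.comap_le hV (s := Y ⁻¹' B) ⟨B, hB, rfl⟩
    rw [setIntegral_congr_ae (hY hB) (hc.mono fun ω hω _ => hω), ← integral_indicator (hY hB),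
      ← integral_indicator (hY hB)] at h
    refine Eq.trans (integral_congr_ae (Filter.Eventually.of_forall fun ω => ?_))
      (h.trans (integral_congr_ae (Filter.Eventually.of_forall fun ω => ?_))) <;>
    · by_cases hω : Y ω ∈ B <;> simp [hω]
  have hmap := (indepFun_iff_map_prod_eq_prod_map_map (hY.prodMk hW).aemeasurable
    hO.aemeasurable).1 hind
  have htriple : Measurable (fun ω => ((Y ω, W ω), O ω)) := (hY.prodMk hW).prodMk hO
  have : IsProbabilityMeasure (P.map O) := Measure.isProbabilityMeasure_map hO.aemeasurable
  have : IsProbabilityMeasure (P.map fun ω => (Y ω, W ω)) :=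
    Measure.isProbabilityMeasure_map (hY.prodMk hW).aemeasurable
  -- By independence O can be frozen at a value o. An event of (Y, O) then becomes its section, an
  -- event of Y alone.
  have hfub : ∀ (h : 𝓨 × 𝓥 → ℝ), Measurable h → Integrable (fun ω => h (Y ω, W ω)) P →
      ∀ C : Set (𝓨 × 𝓞), MeasurableSet C →
      ∫ ω in (fun ω => (Y ω, O ω)) ⁻¹' C, h (Y ω, W ω) ∂P =
        ∫ o, ∫ ω, ((fun y => (y, o)) ⁻¹' C).indicator 1 (Y ω) * h (Y ω, W ω) ∂P ∂(P.map O) := by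
    intro h hh hi C hC
    have hD : Measurable (fun p : (𝓨 × 𝓥) × 𝓞 => C.indicator (1 : 𝓨 × 𝓞 → ℝ) (p.1.1, p.2)
        * h p.1) :=
      ((measurable_one.indicator hC).comp (by fun_prop)).mul (hh.comp measurable_fst)
    have hi' : Integrable h (P.map fun ω => (Y ω, W ω)) :=
      (integrable_map_measure hh.aestronglyMeasurable (hY.prodMk hW).aemeasurable).2 hi
    have hDi : Integrable (fun p : (𝓨 × 𝓥) × 𝓞 => C.indicator (1 : 𝓨 × 𝓞 → ℝ) (p.1.1, p.2)
        * h p.1) ((P.map fun ω => (Y ω, W ω)).prod (P.map O)) := by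
      refine (hi'.comp_fst (P.map O)).mono hD.aestronglyMeasurable
        (Filter.Eventually.of_forall fun p => ?_)
      by_cases hp : (p.1.1, p.2) ∈ C <;> simp [hp]
    rw [← integral_indicator (hYO hC)]
    trans ∫ ω, C.indicator (1 : 𝓨 × 𝓞 → ℝ) (Y ω, O ω) * h (Y ω, W ω) ∂P
    · refine integral_congr_ae (Filter.Eventually.of_forall fun ω => ?_)
      by_cases hω : (Y ω, O ω) ∈ C <;> simp [hω]
    rw [← integral_map (φ := fun ω => ((Y ω, W ω), O ω))
      (f := fun p : (𝓨 × 𝓥) × 𝓞 => C.indicator (1 : 𝓨 × 𝓞 → ℝ) (p.1.1, p.2) * h p.1)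
      htriple.aemeasurable hD.aestronglyMeasurable, hmap, integral_prod_symm _ hDi]
    refine integral_congr_ae (Filter.Eventually.of_forall fun o => ?_)
    simp only
    rw [integral_map (f := fun x : 𝓨 × 𝓥 => C.indicator (1 : 𝓨 × 𝓞 → ℝ) (x.1, o) * h x)
      (hY.prodMk hW).aemeasurable
      (hD.comp measurable_prodMk_right).aestronglyMeasurable]
    rfl
  refine (ae_eq_condExp_of_forall_setIntegral_eq hYO.comap_le hV
    (fun s _ _ => hfi.integrableOn) ?_ ?_).symm
  · rintro s ⟨C, hC, rfl⟩ _
    rw [hfub (fun p => f p.1) (hf.comp measurable_fst) hfi C hC,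
      hfub (fun p => v p.2) (hv.comp measurable_snd) hV C hC]
    refine integral_congr_ae (Filter.Eventually.of_forall fun o => ?_)
    exact hset _ (measurable_prodMk_right hC)
  · exact ((hf.comp measurable_fst).comp
      (comap_measurable (fun ω => (Y ω, O ω)))).stronglyMeasurable.aestronglyMeasurable

end MeanSquaredError

/-! ### Conditional mean in a standard skew normal pair -/

section SkewNormal

variable {ι κ : Type*} [Fintype ι] [Fintype κ]

theorem measurable_WPhi : Measurable WPhi := (measurable_gaussianPDFReal 0 1).div measurable_Phi

theorem WPhi_mul_Phi (t : ℝ) : WPhi t * Phi t = gaussianPDFReal 0 1 t :=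
  div_mul_cancel₀ _ (Phi_pos t).ne'

theorem WPhi_nonneg (t : ℝ) : 0 ≤ WPhi t :=
  div_nonneg (gaussianPDFReal_nonneg _ _ _) (Phi_nonneg t)

theorem gaussianPDFReal_zero_one_le_one (t : ℝ) : gaussianPDFReal 0 1 t ≤ 1 := by
  unfold gaussianPDFReal
  refine mul_le_one₀ (inv_le_one_of_one_le₀ ?_) (Real.exp_nonneg _) (Real.exp_le_one_iff.2 ?_)
  · rw [Real.one_le_sqrt]
    have := Real.two_le_pi
    simp only [NNReal.coe_one]
    linarith
  · simp only [NNReal.coe_one, sub_zero]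
    nlinarith [sq_nonneg t]

theorem measurable_dotProduct_right (a : ι → ℝ) : Measurable (fun x : ι → ℝ => a ⬝ᵥ x) := by
  simp only [dotProduct]
  fun_prop

/-- The density `2 Φ(a₁ᵀx₁ + a₂ᵀx₂)` of a standard skew normal vector with respect to the standard
normal distribution. -/
noncomputable def skewDensity (a₁ : ι → ℝ) (a₂ : κ → ℝ) (p : (ι → ℝ) × (κ → ℝ)) : ℝ :=
  2 * Phi (a₁ ⬝ᵥ p.1 + a₂ ⬝ᵥ p.2)

/-- The standard skew normal distribution on a pair of vectors. -/
noncomputable def stdSkewNormal (a₁ : ι → ℝ) (a₂ : κ → ℝ) : Measure ((ι → ℝ) × (κ → ℝ)) :=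
  ((stdNormal ι).prod (stdNormal κ)).withDensity fun p => ENNReal.ofReal (skewDensity a₁ a₂ p)

variable (a₁ : ι → ℝ) (a₂ : κ → ℝ)

theorem measurable_skewDensity : Measurable (skewDensity a₁ a₂) :=
  (measurable_Phi.comp (((measurable_dotProduct_right a₁).comp measurable_fst).add
    ((measurable_dotProduct_right a₂).comp measurable_snd))).const_mul 2

theorem skewDensity_nonneg (p : (ι → ℝ) × (κ → ℝ)) : 0 ≤ skewDensity a₁ a₂ p :=
  mul_nonneg zero_le_two (Phi_nonneg _)

theorem skewDensity_le_two (p : (ι → ℝ) × (κ → ℝ)) : skewDensity a₁ a₂ p ≤ 2 := by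
  have := Phi_le_one (a₁ ⬝ᵥ p.1 + a₂ ⬝ᵥ p.2)
  unfold skewDensity
  linarith

theorem integrable_stdSkewNormal_iff {f : (ι → ℝ) × (κ → ℝ) → ℝ} :
    Integrable f (stdSkewNormal a₁ a₂) ↔
      Integrable (fun p => skewDensity a₁ a₂ p * f p) ((stdNormal ι).prod (stdNormal κ)) := by
  unfold stdSkewNormal
  rw [integrable_withDensity_iff_integrable_smul'
    (measurable_skewDensity a₁ a₂).ennreal_ofReal (by simp)]
  simp only [ENNReal.toReal_ofReal (skewDensity_nonneg a₁ a₂ _), smul_eq_mul]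

theorem integral_stdSkewNormal (f : (ι → ℝ) × (κ → ℝ) → ℝ) :
    ∫ p, f p ∂(stdSkewNormal a₁ a₂) =
      ∫ p, skewDensity a₁ a₂ p * f p ∂((stdNormal ι).prod (stdNormal κ)) := by
  unfold stdSkewNormal
  rw [integral_withDensity_eq_integral_toReal_smul
    (measurable_skewDensity a₁ a₂).ennreal_ofReal (by simp)]
  simp only [ENNReal.toReal_ofReal (skewDensity_nonneg a₁ a₂ _), smul_eq_mul]

theorem integrable_stdSkewNormal_of_integrable {f : (ι → ℝ) × (κ → ℝ) → ℝ}
    (hf : Integrable f ((stdNormal ι).prod (stdNormal κ))) :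
    Integrable f (stdSkewNormal a₁ a₂) := by
  rw [integrable_stdSkewNormal_iff]
  refine hf.bdd_mul (c := 2) (measurable_skewDensity a₁ a₂).aestronglyMeasurable
    (Filter.Eventually.of_forall fun p => ?_)
  rw [Real.norm_of_nonneg (skewDensity_nonneg _ _ _)]
  exact skewDensity_le_two _ _ _

instance : IsFiniteMeasure (stdSkewNormal a₁ a₂) := by
  have h := integrable_stdSkewNormal_of_integrable a₁ a₂ (integrable_const (1 : ℝ))
  exact ((integrable_const_iff (c := (1 : ℝ))).1 h).resolve_left one_ne_zero

theorem integral_skewDensity_right (x : ι → ℝ) :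
    ∫ y, skewDensity a₁ a₂ (x, y) ∂(stdNormal κ) =
      2 * Phi (a₁ ⬝ᵥ x / √(1 + a₂ ⬝ᵥ a₂)) := by
  simp only [skewDensity]
  rw [integral_const_mul, integral_Phi_add_dotProduct]

theorem integrable_fst_stdSkewNormal (c : ι → ℝ) :
    Integrable (fun p : (ι → ℝ) × (κ → ℝ) => c ⬝ᵥ p.1) (stdSkewNormal a₁ a₂) :=
  integrable_stdSkewNormal_of_integrable a₁ a₂
    (((memLp_dotProduct_stdNormal c).integrable one_le_two).comp_fst _)

theorem integrable_snd_stdSkewNormal (c : κ → ℝ) :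
    Integrable (fun p : (ι → ℝ) × (κ → ℝ) => c ⬝ᵥ p.2) (stdSkewNormal a₁ a₂) :=
  integrable_stdSkewNormal_of_integrable a₁ a₂
    (((memLp_dotProduct_stdNormal c).integrable one_le_two).comp_snd _)

theorem measurable_WPhi_dotProduct_div (s : ℝ) :
    Measurable (fun x : ι → ℝ => WPhi (a₁ ⬝ᵥ x / s)) :=
  measurable_WPhi.comp ((measurable_dotProduct_right a₁).div_const s)

theorem integrable_skewDensity_right (x : ι → ℝ) :
    Integrable (fun y => skewDensity a₁ a₂ (x, y)) (stdNormal κ) := by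
  refine Integrable.of_bound (C := 2)
    ((measurable_skewDensity a₁ a₂).comp measurable_prodMk_left).aestronglyMeasurable
    (Filter.Eventually.of_forall fun y => ?_)
  rw [Real.norm_of_nonneg (skewDensity_nonneg _ _ _)]
  exact skewDensity_le_two _ _ _

/-- W_Φ is unbounded, but integrating out the second vector multiplies it by 2Φ at the same
argument, and W_Φ Φ = φ₁ is bounded. -/
theorem integrable_WPhi_stdSkewNormal :
    Integrable (fun p : (ι → ℝ) × (κ → ℝ) => WPhi (a₁ ⬝ᵥ p.1 / √(1 + a₂ ⬝ᵥ a₂)))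
      (stdSkewNormal a₁ a₂) := by
  have hm : Measurable (fun p : (ι → ℝ) × (κ → ℝ) => skewDensity a₁ a₂ p *
      WPhi (a₁ ⬝ᵥ p.1 / √(1 + a₂ ⬝ᵥ a₂))) :=
    (measurable_skewDensity a₁ a₂).mul
      ((measurable_WPhi_dotProduct_div a₁ _).comp measurable_fst)
  rw [integrable_stdSkewNormal_iff, integrable_prod_iff hm.aestronglyMeasurable]
  refine ⟨Filter.Eventually.of_forall fun x =>
    (integrable_skewDensity_right a₁ a₂ x).mul_const
      (WPhi (a₁ ⬝ᵥ x / √(1 + a₂ ⬝ᵥ a₂))), ?_⟩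
  have : ∀ x : ι → ℝ, ∫ y, ‖skewDensity a₁ a₂ (x, y) * WPhi (a₁ ⬝ᵥ x / √(1 + a₂ ⬝ᵥ a₂))‖
      ∂(stdNormal κ) = 2 * gaussianPDFReal 0 1 (a₁ ⬝ᵥ x / √(1 + a₂ ⬝ᵥ a₂)) := by
    intro x
    simp only [Real.norm_of_nonneg (mul_nonneg (skewDensity_nonneg _ _ _) (WPhi_nonneg _))]
    rw [integral_mul_const, integral_skewDensity_right, ← WPhi_mul_Phi]
    ring
  simp only [this]
  refine Integrable.of_bound (C := 2)
    (((measurable_gaussianPDFReal 0 1).comp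
      ((measurable_dotProduct_right a₁).div_const _)).const_mul 2).aestronglyMeasurable
    (Filter.Eventually.of_forall fun x => ?_)
  rw [Real.norm_of_nonneg (mul_nonneg zero_le_two (gaussianPDFReal_nonneg _ _ _))]
  linarith [gaussianPDFReal_zero_one_le_one (a₁ ⬝ᵥ x / √(1 + a₂ ⬝ᵥ a₂))]

theorem integral_skewDensity_mul_dotProduct_right (c : κ → ℝ) (x : ι → ℝ) :
    ∫ y, skewDensity a₁ a₂ (x, y) * (c ⬝ᵥ y) ∂(stdNormal κ) =
      2 * ((c ⬝ᵥ a₂) / √(1 + a₂ ⬝ᵥ a₂) *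
        gaussianPDFReal 0 1 (a₁ ⬝ᵥ x / √(1 + a₂ ⬝ᵥ a₂))) := by
  have hi : ∀ k, Integrable (fun y : κ → ℝ => y k * Phi (a₁ ⬝ᵥ x + a₂ ⬝ᵥ y)) (stdNormal κ) := by
    intro k
    refine ((memLp_eval_stdNormal k).integrable one_le_two).mul_bdd (c := 1)
      (measurable_Phi.comp ((measurable_dotProduct_right a₂).const_add _)).aestronglyMeasurable
      (Filter.Eventually.of_forall fun y => ?_)
    rw [Real.norm_of_nonneg (Phi_nonneg _)]
    exact Phi_le_one _
  have : ∀ y : κ → ℝ, skewDensity a₁ a₂ (x, y) * (c ⬝ᵥ y) =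
      ∑ k, 2 * c k * (y k * Phi (a₁ ⬝ᵥ x + a₂ ⬝ᵥ y)) := by
    intro y
    simp only [skewDensity, dotProduct, Finset.mul_sum]
    exact Finset.sum_congr rfl fun k _ => by ring
  simp only [this]
  rw [integral_finsetSum _ fun k _ => (hi k).const_mul _]
  simp only [integral_const_mul, integral_eval_mul_Phi_add_dotProduct]
  rw [show c ⬝ᵥ a₂ = ∑ k, c k * a₂ k from rfl, Finset.sum_div, Finset.sum_mul, Finset.mul_sum]
  exact Finset.sum_congr rfl fun k _ => by ring

/-- The conditional mean of `cᵀX₂` given `X₁` for a standard skew normal pair `(X₁, X₂)`. -/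
theorem setIntegral_stdSkewNormal_eq_zero (c : κ → ℝ) {B : Set (ι → ℝ)} (hB : MeasurableSet B) :
    ∫ p in Prod.fst ⁻¹' B, (c ⬝ᵥ p.2 - WPhi (a₁ ⬝ᵥ p.1 / √(1 + a₂ ⬝ᵥ a₂)) *
      ((c ⬝ᵥ a₂) / √(1 + a₂ ⬝ᵥ a₂))) ∂(stdSkewNormal a₁ a₂) = 0 := by
  have hB' : MeasurableSet (Prod.fst ⁻¹' B : Set ((ι → ℝ) × (κ → ℝ))) := measurable_fst hB
  have hi : Integrable (fun p : (ι → ℝ) × (κ → ℝ) => c ⬝ᵥ p.2 -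
      WPhi (a₁ ⬝ᵥ p.1 / √(1 + a₂ ⬝ᵥ a₂)) * ((c ⬝ᵥ a₂) / √(1 + a₂ ⬝ᵥ a₂)))
      (stdSkewNormal a₁ a₂) :=
    (integrable_snd_stdSkewNormal a₁ a₂ c).sub ((integrable_WPhi_stdSkewNormal a₁ a₂).mul_const _)
  have hi' := (integrable_stdSkewNormal_iff a₁ a₂).1 (hi.indicator hB')
  rw [← integral_indicator hB', integral_stdSkewNormal, integral_prod _ hi']
  -- The event depends on the first vector only, so the inner integral over the second vanishes for
  -- each fixed x.
  refine integral_eq_zero_of_ae (Filter.Eventually.of_forall fun x => ?_)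
  by_cases hx : x ∈ B
  · have hsub : ∀ y : κ → ℝ, skewDensity a₁ a₂ (x, y) * (Prod.fst ⁻¹' B).indicator
        (fun p : (ι → ℝ) × (κ → ℝ) => c ⬝ᵥ p.2 - WPhi (a₁ ⬝ᵥ p.1 / √(1 + a₂ ⬝ᵥ a₂)) *
          ((c ⬝ᵥ a₂) / √(1 + a₂ ⬝ᵥ a₂))) (x, y) = skewDensity a₁ a₂ (x, y) * (c ⬝ᵥ y) -
        skewDensity a₁ a₂ (x, y) * (WPhi (a₁ ⬝ᵥ x / √(1 + a₂ ⬝ᵥ a₂)) *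
          ((c ⬝ᵥ a₂) / √(1 + a₂ ⬝ᵥ a₂))) := by
      intro y
      rw [Set.indicator_of_mem (by exact hx), mul_sub]
    simp only [hsub]
    have hi1 : Integrable (fun y => skewDensity a₁ a₂ (x, y) * (c ⬝ᵥ y)) (stdNormal κ) := by
      refine ((memLp_dotProduct_stdNormal c).integrable one_le_two).bdd_mul (c := 2)
        ((measurable_skewDensity a₁ a₂).comp measurable_prodMk_left).aestronglyMeasurable
        (Filter.Eventually.of_forall fun y => ?_)
      rw [Real.norm_of_nonneg (skewDensity_nonneg _ _ _)]
      exact skewDensity_le_two _ _ _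
    rw [integral_sub hi1 ((integrable_skewDensity_right a₁ a₂ x).mul_const _),
      integral_skewDensity_mul_dotProduct_right, integral_mul_const, integral_skewDensity_right,
      ← WPhi_mul_Phi]
    simp only [Pi.zero_apply]
    ring
  · simp only [Set.indicator, Set.mem_preimage, hx, if_false, mul_zero, integral_zero]
    rfl

end SkewNormal

/-! ### Expectations under the SMSN law as standard normal integrals -/

section Representation

variable {ι : Type*} [Fintype ι]

theorem measurable_const_mulVec {κ : Type*} [Finite κ] (A : Matrix κ ι ℝ) :
    Measurable (fun x : ι → ℝ => A *ᵥ x) :=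
  measurable_pi_lambda _ fun i => measurable_dotProduct_right (A i)

variable [DecidableEq ι]

theorem measurable_normalPDF (mu : ι → ℝ) (S : Matrix ι ι ℝ) : Measurable (normalPDF mu S) := by
  unfold normalPDF
  simp only [dotProduct, mulVec, Pi.sub_apply]
  fun_prop

theorem dotProduct_sqrt_inv_mulVec (S : Matrix ι ι ℝ) (lam z : ι → ℝ) :
    lam ⬝ᵥ (CFC.sqrt S⁻¹ *ᵥ z) = (CFC.sqrt S⁻¹ *ᵥ lam) ⬝ᵥ z := by
  have hsym : (CFC.sqrt S⁻¹)ᵀ = CFC.sqrt S⁻¹ := by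
    simpa using (nonneg_iff_posSemidef.1 (CFC.sqrt_nonneg S⁻¹)).1.eq
  rw [dotProduct_mulVec, ← mulVec_transpose, hsym]

/-- The change of variables uses the factor u^{-1/2}A of u⁻¹S. The two powers of u cancel inside Φ,
so u survives only in the argument of f. -/
theorem lintegral_condPDF_mul {A S : Matrix ι ι ℝ} (hA : A.det ≠ 0) (hS : A * Aᵀ = S)
    (mu lam : ι → ℝ) {u : ℝ} (hu : 0 < u) {f : (ι → ℝ) → ℝ≥0∞} (hf : Measurable f) :
    ∫⁻ y, ENNReal.ofReal (condPDF mu S lam u y) * f y =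
      ∫⁻ x, ENNReal.ofReal (2 * Phi ((CFC.sqrt S⁻¹ *ᵥ lam) ⬝ᵥ (A *ᵥ x))) *
        f (mu + (√u)⁻¹ • (A *ᵥ x)) ∂(stdNormal ι) := by
  have hsu : 0 < √u := Real.sqrt_pos.2 hu
  have hA' : ((√u)⁻¹ • A).det ≠ 0 := by
    rw [det_smul]
    exact mul_ne_zero (pow_ne_zero _ (inv_ne_zero hsu.ne')) hA
  have hS' : ((√u)⁻¹ • A) * ((√u)⁻¹ • A)ᵀ = u⁻¹ • S := by
    rw [transpose_smul, smul_mul_smul_comm, hS, ← mul_inv, Real.mul_self_sqrt hu.le]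
  have hg : Measurable (fun y => ENNReal.ofReal
      (2 * Phi (√u * (lam ⬝ᵥ (CFC.sqrt S⁻¹ *ᵥ (y - mu))))) * f y) := by
    refine (Measurable.ennreal_ofReal ((measurable_Phi.comp (Measurable.const_mul ?_ _)).const_mul
      2)).mul hf
    exact (measurable_dotProduct_right lam).comp
      ((measurable_const_mulVec _).comp (measurable_id.sub_const mu))
  have h := lintegral_normalPDF_mul hA' hS' mu hg (measurable_normalPDF _ _)
  refine Eq.trans (lintegral_congr fun y => ?_) (h.trans (lintegral_congr fun x => ?_))
  · rw [← mul_assoc, ← ENNReal.ofReal_mul (by unfold normalPDF; positivity), condPDF]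
    congr 2
    ring
  · rw [smul_mulVec, add_sub_cancel_left, dotProduct_sqrt_inv_mulVec, dotProduct_smul, smul_eq_mul,
      mul_inv_cancel_left₀ hsu.ne']

theorem IsSMSN.lintegral_eq {Ω : Type*} [MeasurableSpace Ω] {P : Measure Ω}
    {Y : Ω → ι → ℝ} {U : Ω → ℝ} {mu : ι → ℝ} {S A : Matrix ι ι ℝ} {lam : ι → ℝ} {H : Measure ℝ}
    [SFinite H] (h : IsSMSN P Y U mu S lam H) (hY : Measurable Y) (hU : Measurable U)
    (hH : ∀ᵐ u ∂H, 0 < u) (hA : A.det ≠ 0) (hS : A * Aᵀ = S)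
    {F : ℝ × (ι → ℝ) → ℝ≥0∞} (hF : Measurable F) :
    ∫⁻ ω, F (U ω, Y ω) ∂P = ∫⁻ u, ∫⁻ x,
      ENNReal.ofReal (2 * Phi ((CFC.sqrt S⁻¹ *ᵥ lam) ⬝ᵥ (A *ᵥ x))) *
        F (u, mu + (√u)⁻¹ • (A *ᵥ x)) ∂(stdNormal ι) ∂H := by
  have hm : Measurable (fun p : ℝ × (ι → ℝ) => ENNReal.ofReal (condPDF mu S lam p.1 p.2)) :=
    (measurable_condPDF mu S lam).ennreal_ofReal
  rw [← lintegral_map hF (hU.prodMk hY), h.map_joint, lintegral_withDensity_eq_lintegral_mul _ hm hF,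
    lintegral_prod _ (hm.mul hF).aemeasurable]
  refine lintegral_congr_ae ?_
  filter_upwards [hH] with u hu
  exact lintegral_condPDF_mul hA hS mu lam hu (hF.comp measurable_prodMk_left)

end Representation

/-! ### The mixed model: representation and conditional mean of the future vector -/

namespace Model

variable {l q m r : ℕ} (M : Model l q m r)

theorem posDef_Psi (hD : M.D.PosDef) (hSigma : M.Sigma.PosDef) : M.Psi.PosDef :=
  hSigma.add_posSemidef (by simpa using hD.posSemidef.mul_mul_conjTranspose_same M.Zstar)

/-- The location of the observed vector. -/
noncomputable def loc1 : Fin m → ℝ := M.X *ᵥ M.beta + M.c • (M.Z *ᵥ M.Delta)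

/-- The location of the future vector. -/
noncomputable def loc2 : Fin r → ℝ := M.Xp *ᵥ M.beta + M.c • (M.Zp *ᵥ M.Delta)

theorem loc_eq : M.loc = Sum.elim M.loc1 M.loc2 := by
  ext (i | i) <;> simp [loc, loc1, loc2, Xstar, Zstar, fromRows_mulVec]

theorem resid_eq (y : Fin m → ℝ) : M.resid y = y - M.loc1 := sub_sub _ _ _

theorem mu2_1_eq (y : Fin m → ℝ) :
    M.mu2_1 y = M.loc2 + (M.Psi21 * M.Psi11⁻¹) *ᵥ M.resid y := by
  rw [← mulVec_mulVec]
  rfl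

/-- The stacked observation with mixing variable `u` as a function of a standard skew normal
pair. -/
noncomputable def stack (L₁ : Matrix (Fin m) (Fin m) ℝ) (L₂ : Matrix (Fin r) (Fin r) ℝ)
    (p : ℝ × ((Fin m → ℝ) × (Fin r → ℝ))) : ℝ × ((Fin m → ℝ) × (Fin r → ℝ)) :=
  (p.1, M.loc1 + (√p.1)⁻¹ • (L₁ *ᵥ p.2.1),
    M.loc2 + (√p.1)⁻¹ • ((M.Psi21 * M.Psi11⁻¹) *ᵥ (L₁ *ᵥ p.2.1) + L₂ *ᵥ p.2.2))

theorem measurable_stack (L₁ : Matrix (Fin m) (Fin m) ℝ) (L₂ : Matrix (Fin r) (Fin r) ℝ) :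
    Measurable (M.stack L₁ L₂) := by
  have hs : Measurable (fun p : ℝ × ((Fin m → ℝ) × (Fin r → ℝ)) => (√p.1)⁻¹) := by fun_prop
  have h1 : Measurable (fun p : ℝ × ((Fin m → ℝ) × (Fin r → ℝ)) => L₁ *ᵥ p.2.1) :=
    (measurable_const_mulVec L₁).comp (by fun_prop)
  have h2 : Measurable (fun p : ℝ × ((Fin m → ℝ) × (Fin r → ℝ)) => L₂ *ᵥ p.2.2) :=
    (measurable_const_mulVec L₂).comp (by fun_prop)
  exact measurable_fst.prodMk (((hs.smul h1).const_add _).prodMk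
    ((hs.smul (((measurable_const_mulVec _).comp h1).add h2)).const_add _))

variable {M}

/-- The mixing variable, the observed vector and the future vector in terms of a standard skew
normal pair. -/
theorem exists_map_eq_map_stack (hD : M.D.PosDef) (hSigma : M.Sigma.PosDef)
    [IsProbabilityMeasure M.H] (hHpos : ∀ᵐ u ∂M.H, 0 < u)
    {Ω : Type*} [MeasurableSpace Ω] {P : Measure Ω}
    {Y : Ω → Fin m → ℝ} {Yp : Ω → Fin r → ℝ} {U : Ω → ℝ}
    (hY : Measurable Y) (hYp : Measurable Yp) (hU : Measurable U)
    (hjoint : IsSMSN P (fun ω => Sum.elim (Y ω) (Yp ω)) U M.loc M.Psi M.lamBar M.H) :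
    ∃ (L₁ : Matrix (Fin m) (Fin m) ℝ) (L₂ : Matrix (Fin r) (Fin r) ℝ)
      (a₁ : Fin m → ℝ) (a₂ : Fin r → ℝ),
      P.map (fun ω => (U ω, (Y ω, Yp ω))) =
        (M.H.prod (stdSkewNormal a₁ a₂)).map (M.stack L₁ L₂) ∧
      √(1 + a₂ ⬝ᵥ a₂) = M.scale ∧
      (∀ x, M.upsilonTilde ⬝ᵥ (L₁ *ᵥ x) = a₁ ⬝ᵥ x / M.scale) ∧
      M.Psi22_1 *ᵥ M.upsilon2 = L₂ *ᵥ a₂ := by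
  obtain ⟨L₁, L₂, hd₁, hd₂, hL₂, hA, hsym, h21⟩ :=
    exists_block_factor (M.posDef_Psi hD hSigma)
  have hL₂' : L₂ * L₂ᵀ = M.Psi22_1 := hL₂
  set K : Matrix (Fin r) (Fin m) ℝ := M.Psi21 * M.Psi11⁻¹ with hK
  set A : Matrix (Fin m ⊕ Fin r) (Fin m ⊕ Fin r) ℝ := fromBlocks L₁ 0 (K * L₁) L₂ with hAdef
  have hAS : A * Aᵀ = M.Psi := hA
  have hAdet : A.det ≠ 0 := by
    rw [hAdef, det_fromBlocks_zero₁₂]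
    exact mul_ne_zero hd₁ hd₂
  have hKt : Kᵀ = M.Psi11⁻¹ * M.Psi12 := by
    rw [hK, transpose_mul, transpose_nonsing_inv]
    exact congrArg₂ (fun B C => B⁻¹ * C) hsym h21
  -- a₁ and a₂ are the two blocks of Aᵀυ, so that υᵀAx = a₁ᵀx₁ + a₂ᵀx₂.
  set a₁ : Fin m → ℝ := L₁ᵀ *ᵥ (M.upsilon1 + Kᵀ *ᵥ M.upsilon2) with ha₁
  set a₂ : Fin r → ℝ := L₂ᵀ *ᵥ M.upsilon2 with ha₂
  have hscale : √(1 + a₂ ⬝ᵥ a₂) = M.scale := by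
    rw [scale, ← hL₂', ← mulVec_mulVec, dotProduct_mulVec _ L₂, ← mulVec_transpose]
  have hmul : ∀ x : Fin m ⊕ Fin r → ℝ, A *ᵥ x =
      Sum.elim (L₁ *ᵥ (x ∘ Sum.inl)) (K *ᵥ (L₁ *ᵥ (x ∘ Sum.inl)) + L₂ *ᵥ (x ∘ Sum.inr)) := by
    intro x
    rw [hAdef, fromBlocks_mulVec, zero_mulVec, add_zero, mulVec_mulVec]
  have hdot : ∀ x : Fin m ⊕ Fin r → ℝ, M.upsilon ⬝ᵥ (A *ᵥ x) =
      a₁ ⬝ᵥ (x ∘ Sum.inl) + a₂ ⬝ᵥ (x ∘ Sum.inr) := by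
    intro x
    have hups : M.upsilon = Sum.elim M.upsilon1 M.upsilon2 := by
      ext (i | i) <;> rfl
    rw [hmul, hups, sumElim_dotProduct_sumElim, ha₁, ha₂, mulVec_transpose, mulVec_transpose,
      mulVec_transpose, ← dotProduct_mulVec, ← dotProduct_mulVec, dotProduct_add, add_dotProduct,
      ← dotProduct_mulVec, add_assoc]
  refine ⟨L₁, L₂, a₁, a₂, ?_, hscale, fun x => ?_, ?_⟩
  · ext s hs
    have hmap : Measurable (fun ω => (U ω, (Y ω, Yp ω))) := hU.prodMk (hY.prodMk hYp)
    have hYY : Measurable (fun ω => Sum.elim (Y ω) (Yp ω)) := by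
      refine measurable_pi_lambda _ ?_
      rintro (i | i)
      · exact (measurable_pi_apply i).comp hY
      · exact (measurable_pi_apply i).comp hYp
    have hsplit : Measurable (fun p : ℝ × (Fin m ⊕ Fin r → ℝ) =>
        (p.1, (p.2 ∘ Sum.inl, p.2 ∘ Sum.inr))) :=
      measurable_fst.prodMk ((measurable_pi_lambda _ fun i => by fun_prop).prodMk
        (measurable_pi_lambda _ fun i => by fun_prop))
    have hind : Measurable (s.indicator (1 : ℝ × ((Fin m → ℝ) × (Fin r → ℝ)) → ℝ≥0∞)) :=
      measurable_one.indicator hs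
    have h := hjoint.lintegral_eq hYY hU hHpos hAdet hAS (hind.comp hsplit)
    have hst := M.measurable_stack L₁ L₂
    have hmp : MeasurePreserving (MeasurableEquiv.sumPiEquivProdPi fun _ : Fin m ⊕ Fin r => ℝ)
        (stdNormal (Fin m ⊕ Fin r)) ((stdNormal (Fin m)).prod (stdNormal (Fin r))) :=
      measurePreserving_sumPiEquivProdPi fun _ : Fin m ⊕ Fin r => gaussianReal 0 1
    rw [← lintegral_indicator_one hs, ← lintegral_indicator_one hs, lintegral_map hind hmap,
      lintegral_map hind hst, lintegral_prod
        (fun p => s.indicator 1 (M.stack L₁ L₂ p)) (hind.comp hst).aemeasurable]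
    refine h.trans (lintegral_congr fun u => ?_)
    have hind' : Measurable (fun x => s.indicator (1 : ℝ × ((Fin m → ℝ) × (Fin r → ℝ)) → ℝ≥0∞)
        (M.stack L₁ L₂ (u, x))) :=
      (hind.comp hst).comp measurable_prodMk_left
    rw [stdSkewNormal, lintegral_withDensity_eq_lintegral_mul _
      (measurable_skewDensity a₁ a₂).ennreal_ofReal
      hind', ← hmp.lintegral_comp ((measurable_skewDensity a₁ a₂).ennreal_ofReal.mul hind')]
    refine lintegral_congr fun x => ?_
    have e1 : 2 * Phi ((CFC.sqrt M.Psi⁻¹ *ᵥ M.lamBar) ⬝ᵥ (A *ᵥ x)) =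
        skewDensity a₁ a₂ (x ∘ Sum.inl, x ∘ Sum.inr) := by
      rw [skewDensity, ← hdot]
      rfl
    rw [e1]
    have e2 : (fun p : ℝ × (Fin m ⊕ Fin r → ℝ) => (p.1, (p.2 ∘ Sum.inl, p.2 ∘ Sum.inr)))
        (u, M.loc + (√u)⁻¹ • (A *ᵥ x)) = M.stack L₁ L₂ (u, (x ∘ Sum.inl, x ∘ Sum.inr)) := by
      rw [hmul, loc_eq]
      rfl
    exact congrArg (fun z => ENNReal.ofReal (skewDensity a₁ a₂ (x ∘ Sum.inl, x ∘ Sum.inr)) *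
      s.indicator 1 z) e2
  · rw [upsilonTilde, smul_dotProduct, mulVec_mulVec, ← hKt, ha₁, mulVec_transpose L₁,
      ← dotProduct_mulVec, smul_eq_mul, div_eq_inv_mul]
  · rw [← hL₂', ← mulVec_mulVec]

theorem measurable_resid : Measurable M.resid := by
  simp only [funext M.resid_eq]
  fun_prop

theorem measurable_mu2_1 : Measurable M.mu2_1 := by
  simp only [funext M.mu2_1_eq]
  exact ((measurable_const_mulVec _).comp measurable_resid).const_add _

theorem measurable_tauIntegrand :
    Measurable (fun p : (Fin m → ℝ) × ℝ => M.tauIntegrand p.1 p.2) :=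
  (by fun_prop : Measurable (fun p : (Fin m → ℝ) × ℝ => (√p.2)⁻¹)).mul
    (measurable_WPhi.comp ((by fun_prop : Measurable (fun p : (Fin m → ℝ) × ℝ => √p.2)).mul
      ((measurable_dotProduct_right _).comp (measurable_resid.comp measurable_fst))))

variable {Ω : Type*} [MeasurableSpace Ω] {P : Measure Ω}
  {Y : Ω → Fin m → ℝ} {Yp : Ω → Fin r → ℝ} {U : Ω → ℝ}

theorem measurable_tauTilde [IsProbabilityMeasure P] : Measurable (M.tauTilde P Y U) :=
  (measurable_tauIntegrand.stronglyMeasurable.integral_condDistrib).measurable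

theorem measurable_predictor [IsProbabilityMeasure P] : Measurable (M.predictor P Y U) :=
  measurable_mu2_1.add ((measurable_tauTilde.div_const _).smul_const _)

/-- The conditional mean of the future vector given the observed vector and the mixing variable,
integrated over the events of the observed vector. -/
theorem integrable_and_setIntegral_sub_eq_zero (hD : M.D.PosDef) (hSigma : M.Sigma.PosDef)
    [IsProbabilityMeasure M.H] (hHpos : ∀ᵐ u ∂M.H, 0 < u)
    (hk : Integrable (fun u : ℝ => (√u)⁻¹) M.H)
    (hY : Measurable Y) (hYp : Measurable Yp) (hU : Measurable U)
    (hjoint : IsSMSN P (fun ω => Sum.elim (Y ω) (Yp ω)) U M.loc M.Psi M.lamBar M.H) :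
    Integrable (fun ω => M.tauIntegrand (Y ω) (U ω)) P ∧ ∀ j : Fin r,
    Integrable (fun ω => Yp ω j) P ∧ Integrable (fun ω => M.mu2_1 (Y ω) j) P ∧
    ∀ B : Set (Fin m → ℝ), MeasurableSet B → ∫ ω in Y ⁻¹' B, (Yp ω j - (M.mu2_1 (Y ω) j +
      M.tauIntegrand (Y ω) (U ω) / M.scale * (M.Psi22_1 *ᵥ M.upsilon2) j)) ∂P = 0 := by
  obtain ⟨L₁, L₂, a₁, a₂, hlaw, hscale, htil, hw⟩ :=
    exists_map_eq_map_stack hD hSigma hHpos hY hYp hU hjoint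
  have hmap : Measurable (fun ω => (U ω, (Y ω, Yp ω))) := hU.prodMk (hY.prodMk hYp)
  have hst := M.measurable_stack L₁ L₂
  have hpos : ∀ᵐ p ∂(M.H.prod (stdSkewNormal a₁ a₂)), 0 < p.1 :=
    Measure.quasiMeasurePreserving_fst.ae hHpos
  -- Every variable needed is a constant plus u^{-1/2} g(x), integrable under the product law
  -- because u^{-1/2} and g are.
  have hint : ∀ (F : ℝ × ((Fin m → ℝ) × (Fin r → ℝ)) → ℝ), Measurable F → ∀ (c : ℝ)
      (g : (Fin m → ℝ) × (Fin r → ℝ) → ℝ), Integrable g (stdSkewNormal a₁ a₂) →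
      (∀ u, 0 < u → ∀ x, F (M.stack L₁ L₂ (u, x)) = c + (√u)⁻¹ * g x) →
      Integrable (fun ω => F (U ω, (Y ω, Yp ω))) P := by
    intro F hF c g hg hFg
    refine (integrable_map_measure hF.aestronglyMeasurable hmap.aemeasurable).1 ?_
    rw [hlaw]
    refine (integrable_map_measure hF.aestronglyMeasurable hst.aemeasurable).2 ?_
    refine ((integrable_const c).add (hk.mul_prod hg)).congr ?_
    filter_upwards [hpos] with p hp
    exact (hFg p.1 hp p.2).symm
  have hres : ∀ u x, M.resid (M.stack L₁ L₂ (u, x)).2.1 = (√u)⁻¹ • (L₁ *ᵥ x.1) := by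
    intro u x
    rw [resid_eq, stack, add_sub_cancel_left]
  have hmu : ∀ u x, M.mu2_1 (M.stack L₁ L₂ (u, x)).2.1 =
      M.loc2 + (√u)⁻¹ • ((M.Psi21 * M.Psi11⁻¹) *ᵥ (L₁ *ᵥ x.1)) := by
    intro u x
    rw [mu2_1_eq, hres, mulVec_smul]
  have htau : ∀ u, 0 < u → ∀ x, M.tauIntegrand (M.stack L₁ L₂ (u, x)).2.1 u =
      (√u)⁻¹ * WPhi (a₁ ⬝ᵥ x.1 / √(1 + a₂ ⬝ᵥ a₂)) := by
    intro u hu x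
    rw [tauIntegrand, hres, dotProduct_smul, smul_eq_mul,
      mul_inv_cancel_left₀ (Real.sqrt_pos.2 hu).ne', htil, hscale]
  have hW := integrable_WPhi_stdSkewNormal a₁ a₂
  have hFt : Measurable (fun p : ℝ × ((Fin m → ℝ) × (Fin r → ℝ)) =>
      M.tauIntegrand p.2.1 p.1) :=
    measurable_tauIntegrand.comp
      (by fun_prop : Measurable fun p : ℝ × ((Fin m → ℝ) × (Fin r → ℝ)) => (p.2.1, p.1))
  have i3 : Integrable (fun ω => M.tauIntegrand (Y ω) (U ω)) P := hint _ hFt 0 _ hW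
    fun u hu x => by rw [zero_add]; exact htau u hu x
  refine ⟨i3, fun j => ?_⟩
  have hK1 : Integrable (fun x : (Fin m → ℝ) × (Fin r → ℝ) =>
      ((M.Psi21 * M.Psi11⁻¹) *ᵥ (L₁ *ᵥ x.1)) j) (stdSkewNormal a₁ a₂) := by
    simp only [mulVec_mulVec]
    exact integrable_fst_stdSkewNormal a₁ a₂ _
  have hL2 : Integrable (fun x : (Fin m → ℝ) × (Fin r → ℝ) => (L₂ *ᵥ x.2) j)
      (stdSkewNormal a₁ a₂) := integrable_snd_stdSkewNormal a₁ a₂ _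
  have hFy : Measurable (fun p : ℝ × ((Fin m → ℝ) × (Fin r → ℝ)) => p.2.2 j) := by fun_prop
  have hFm : Measurable (fun p : ℝ × ((Fin m → ℝ) × (Fin r → ℝ)) => M.mu2_1 p.2.1 j) :=
    (measurable_pi_apply j).comp (measurable_mu2_1.comp (by fun_prop))
  have i1 : Integrable (fun ω => Yp ω j) P := hint _ hFy (M.loc2 j) _ (hK1.add hL2)
    fun u _ x => by simp [stack, mul_add]
  have i2 : Integrable (fun ω => M.mu2_1 (Y ω) j) P := hint _ hFm (M.loc2 j) _ hK1
    fun u _ x => by simp only [hmu]; simp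
  refine ⟨i1, i2, fun B hB => ?_⟩
  set D : ℝ × ((Fin m → ℝ) × (Fin r → ℝ)) → ℝ := fun p => p.2.2 j - (M.mu2_1 p.2.1 j +
      M.tauIntegrand p.2.1 p.1 / M.scale * (M.Psi22_1 *ᵥ M.upsilon2) j) with hDdef
  have hDm : Measurable D := hFy.sub (hFm.add ((hFt.div_const _).mul_const _))
  have hDi : Integrable (fun ω => D (U ω, (Y ω, Yp ω))) P :=
    i1.sub (i2.add ((i3.div_const _).mul_const _))
  have hDst : ∀ u, 0 < u → ∀ x, D (M.stack L₁ L₂ (u, x)) = (√u)⁻¹ * (L₂ j ⬝ᵥ x.2 -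
      WPhi (a₁ ⬝ᵥ x.1 / √(1 + a₂ ⬝ᵥ a₂)) * ((L₂ j ⬝ᵥ a₂) / √(1 + a₂ ⬝ᵥ a₂))) := by
    intro u hu x
    have hwj : (M.Psi22_1 *ᵥ M.upsilon2) j = L₂ j ⬝ᵥ a₂ := by rw [hw]; rfl
    have hst1 : (M.stack L₁ L₂ (u, x)).1 = u := rfl
    have hst2 : (M.stack L₁ L₂ (u, x)).2.2 j = M.loc2 j + (√u)⁻¹ *
        (((M.Psi21 * M.Psi11⁻¹) *ᵥ (L₁ *ᵥ x.1)) j + L₂ j ⬝ᵥ x.2) := rfl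
    have hmuj : M.mu2_1 (M.stack L₁ L₂ (u, x)).2.1 j = M.loc2 j +
        (√u)⁻¹ * ((M.Psi21 * M.Psi11⁻¹) *ᵥ (L₁ *ᵥ x.1)) j := by rw [hmu]; rfl
    simp only [hDdef, hst1]
    rw [hst2, hmuj, htau u hu x, hwj, ← hscale]
    ring
  have hS : MeasurableSet {p : ℝ × ((Fin m → ℝ) × (Fin r → ℝ)) | p.2.1 ∈ B} :=
    (by fun_prop : Measurable fun p : ℝ × ((Fin m → ℝ) × (Fin r → ℝ)) => p.2.1) hB
  set E := ({p : ℝ × ((Fin m → ℝ) × (Fin r → ℝ)) | p.2.1 ∈ B}).indicator D with hE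
  have hEm : Measurable E := hDm.indicator hS
  have hEi : Integrable (fun p => E (M.stack L₁ L₂ p)) (M.H.prod (stdSkewNormal a₁ a₂)) := by
    refine (integrable_map_measure hEm.aestronglyMeasurable hst.aemeasurable).1 ?_
    rw [← hlaw]
    exact ((integrable_map_measure hDm.aestronglyMeasurable hmap.aemeasurable).2 hDi).indicator hS
  have hEint : ∫ ω in Y ⁻¹' B, D (U ω, (Y ω, Yp ω)) ∂P = ∫ ω, E (U ω, (Y ω, Yp ω)) ∂P := by
    rw [← integral_indicator (hY hB)]
    rfl
  refine hEint.trans ?_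
  rw [← integral_map (f := E) hmap.aemeasurable hEm.aestronglyMeasurable, hlaw,
    integral_map hst.aemeasurable hEm.aestronglyMeasurable, integral_prod _ hEi]
  refine integral_eq_zero_of_ae ?_
  filter_upwards [hHpos] with u hu
  -- For fixed u, the event that Y lies in B is an event of x₁ alone, so the skew normal identity
  -- applies to it.
  have hB' : MeasurableSet ((fun x : Fin m → ℝ => M.loc1 + (√u)⁻¹ • (L₁ *ᵥ x)) ⁻¹' B) :=
    (((measurable_const_mulVec L₁).const_smul (√u)⁻¹).const_add M.loc1) hB
  have hzero := setIntegral_stdSkewNormal_eq_zero a₁ a₂ (L₂ j) hB'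
  rw [← integral_indicator (measurable_fst hB')] at hzero
  have : ∀ x, E (M.stack L₁ L₂ (u, x)) = (√u)⁻¹ * (Prod.fst ⁻¹'
      ((fun x : Fin m → ℝ => M.loc1 + (√u)⁻¹ • (L₁ *ᵥ x)) ⁻¹' B)).indicator
      (fun p : (Fin m → ℝ) × (Fin r → ℝ) => L₂ j ⬝ᵥ p.2 -
        WPhi (a₁ ⬝ᵥ p.1 / √(1 + a₂ ⬝ᵥ a₂)) * ((L₂ j ⬝ᵥ a₂) / √(1 + a₂ ⬝ᵥ a₂))) x := by
    intro x
    by_cases hx : M.loc1 + (√u)⁻¹ • (L₁ *ᵥ x.1) ∈ B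
    · rw [hE, Set.indicator_of_mem (by exact hx), Set.indicator_of_mem (by exact hx), hDst u hu x]
    · rw [hE, Set.indicator_of_notMem (by exact hx), Set.indicator_of_notMem (by exact hx),
        mul_zero]
  simp only [this, integral_const_mul, hzero, mul_zero, Pi.zero_apply]

/-- The predictor is the conditional mean of the future vector given the observed vector. -/
theorem condExp_eq_predictor [IsProbabilityMeasure P] (hD : M.D.PosDef) (hSigma : M.Sigma.PosDef)
    [IsProbabilityMeasure M.H] (hHpos : ∀ᵐ u ∂M.H, 0 < u)
    (hk : Integrable (fun u : ℝ => (√u)⁻¹) M.H)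
    (hY : Measurable Y) (hYp : Measurable Yp) (hU : Measurable U)
    (hjoint : IsSMSN P (fun ω => Sum.elim (Y ω) (Yp ω)) U M.loc M.Psi M.lamBar M.H)
    (j : Fin r) :
    P[fun ω => Yp ω j | MeasurableSpace.pi.comap Y] =ᵐ[P]
      fun ω => M.predictor P Y U (Y ω) j := by
  obtain ⟨i3, hj⟩ :=
    integrable_and_setIntegral_sub_eq_zero hD hSigma hHpos hk hY hYp hU hjoint
  obtain ⟨i1, i2, hz⟩ := hj j
  set w := (M.Psi22_1 *ᵥ M.upsilon2) j with hw
  have hg := i2.add ((i3.div_const M.scale).mul_const w)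
  -- The subtracted term still involves U, so this is not yet the predictor; averaging over the
  -- conditional law of U given Y follows in `h2`.
  have hsub : P[fun ω => Yp ω j - (M.mu2_1 (Y ω) j + M.tauIntegrand (Y ω) (U ω) / M.scale * w) |
      MeasurableSpace.pi.comap Y] =ᵐ[P] 0 := by
    refine (ae_eq_condExp_of_forall_setIntegral_eq hY.comap_le (i1.sub hg)
      (fun s _ _ => integrable_zero _ _ _) ?_ aestronglyMeasurable_zero).symm
    rintro s ⟨B, hB, rfl⟩ _
    exact (integral_zero _ _).trans (hz B hB).symm
  have h1 := condExp_sub i1 hg (MeasurableSpace.pi.comap Y)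
  let F : (Fin m → ℝ) × ℝ → ℝ := fun p => M.mu2_1 p.1 j + M.tauIntegrand p.1 p.2 / M.scale * w
  have hF : Measurable F := ((measurable_pi_apply j).comp (measurable_mu2_1.comp
    measurable_fst)).add ((measurable_tauIntegrand.div_const _).mul_const _)
  have h2 := condExp_prod_ae_eq_integral_condDistrib hY hU.aemeasurable hF.stronglyMeasurable hg
  -- Needed to split the integral of F into its part free of u and the part giving τ̃₋₁.
  have h3 : ∀ᵐ ω ∂P, Integrable (fun u => M.tauIntegrand (Y ω) u) (condDistrib U Y P (Y ω)) :=
    ((integrable_map_measure measurable_tauIntegrand.aestronglyMeasurable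
      (hY.prodMk hU).aemeasurable).2 i3).condDistrib_ae hY.aemeasurable hU.aemeasurable
  filter_upwards [hsub, h1, h2, h3] with ω hω1 hω2 hω3 hω4
  have hω5 : (P[fun ω => Yp ω j | MeasurableSpace.pi.comap Y]) ω =
      ∫ u, F (Y ω, u) ∂(condDistrib U Y P (Y ω)) := by
    rw [← hω3]
    have := hω2.symm.trans hω1
    exact sub_eq_zero.1 this
  rw [hω5]
  simp only [F]
  rw [integral_add (integrable_const _) ((hω4.div_const _).mul_const _), integral_const,
    probReal_univ, one_smul, integral_mul_const, integral_div]
  rfl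

end Model
end SMSN

/-! ### The prediction theorem -/

theorem mainTheorem5 {l q m r : ℕ} (M : SMSN.Model l q m r)
    (hD : M.D.PosDef) (hSigma : M.Sigma.PosDef)
    (hH : IsProbabilityMeasure M.H) (hHpos : ∀ᵐ u ∂M.H, 0 < u)
    (hk : Integrable (fun u : ℝ => (√u)⁻¹) M.H)
    {Ω : Type*} [MeasurableSpace Ω] (P : Measure Ω) [IsProbabilityMeasure P]
    (Y : Ω → Fin m → ℝ) (Yp : Ω → Fin r → ℝ) (U : Ω → ℝ)
    (hY : Measurable Y) (hYp : Measurable Yp) (hU : Measurable U)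
    (hjoint : SMSN.IsSMSN P (fun ω => Sum.elim (Y ω) (Yp ω)) U M.loc M.Psi M.lamBar M.H)
    -- the observations of the other subjects
    {J : Type*} [Fintype J] (dim : J → ℕ) (Yo : Ω → (j : J) → Fin (dim j) → ℝ)
    (hYo : Measurable Yo) (hind : IndepFun (fun ω => (Y ω, Yp ω)) Yo P) :
    (∀ᵐ y ∂(P.map Y),
      Integrable (fun v : Fin r → ℝ => v) (condDistrib Yp Y P y) ∧
      Integrable (M.tauIntegrand y) (condDistrib U Y P y) ∧
      ∫ v, v ∂(condDistrib Yp Y P y) =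
        M.mu2_1 y + (M.tauTilde P Y U y / M.scale) • (M.Psi22_1 *ᵥ M.upsilon2)) ∧
    SMSN.IsMinMSEPredictor P Yp (fun ω => (Y ω, Yo ω)) (fun t => M.predictor P Y U t.1) ∧
    SMSN.IsMinMSEPredictor P Yp Y (M.predictor P Y U) := by
  obtain ⟨htau, hint⟩ :=
    SMSN.Model.integrable_and_setIntegral_sub_eq_zero hD hSigma hHpos hk hY hYp hU hjoint
  have hYpj : ∀ j, Integrable (fun ω => Yp ω j) P := fun j => (hint j).1
  have hYpi : Integrable Yp P := Integrable.of_eval hYpj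
  have hcond := SMSN.Model.condExp_eq_predictor hD hSigma hHpos hk hY hYp hU hjoint
  refine ⟨?_, ?_, SMSN.isMinMSEPredictor_of_condExp hY SMSN.Model.measurable_predictor hYpj hcond⟩
  · have h1 : ∀ᵐ y ∂(P.map Y), Integrable (fun v : Fin r → ℝ => v) (condDistrib Yp Y P y) :=
      ((integrable_map_measure (f := fun ω => (Y ω, Yp ω))
        (g := fun p : (Fin m → ℝ) × (Fin r → ℝ) => p.2)
        measurable_snd.aestronglyMeasurable (hY.prodMk hYp).aemeasurable).2
        hYpi).condDistrib_ae_map hYp.aemeasurable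
    have h2 : ∀ᵐ y ∂(P.map Y), Integrable (M.tauIntegrand y) (condDistrib U Y P y) :=
      ((integrable_map_measure SMSN.Model.measurable_tauIntegrand.aestronglyMeasurable
        (hY.prodMk hU).aemeasurable).2 htau).condDistrib_ae_map hU.aemeasurable
    have h3 : ∀ᵐ y ∂(P.map Y), ∫ v, v ∂(condDistrib Yp Y P y) = M.predictor P Y U y := by
      have hm : Measurable (fun y => ∫ v, v ∂(condDistrib Yp Y P y)) :=
        (StronglyMeasurable.integral_condDistrib
          (f := fun p : (Fin m → ℝ) × (Fin r → ℝ) => p.2)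
          measurable_snd.stronglyMeasurable).measurable
      -- Both sides are measurable in y, so the identity may be checked almost surely at Y, where
      -- each coordinate of either side is a version of the same conditional expectation.
      refine (ae_map_iff hY.aemeasurable
        (measurableSet_eq_fun hm SMSN.Model.measurable_predictor)).2 ?_
      have h1' := ae_of_ae_map hY.aemeasurable h1
      have h4 : ∀ j, P[fun ω => Yp ω j | MeasurableSpace.pi.comap Y] =ᵐ[P]
          fun ω => ∫ v, v j ∂(condDistrib Yp Y P (Y ω)) := fun j =>
        condExp_ae_eq_integral_condDistrib hY hYp.aemeasurable
          (measurable_pi_apply j).stronglyMeasurable (hYpj j)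
      filter_upwards [h1', ae_all_iff.2 hcond, ae_all_iff.2 h4] with ω hω1 hω2 hω3
      funext j
      rw [eval_integral fun i => hω1.eval i, ← hω3, hω2]
    filter_upwards [h1, h2, h3] with y hy1 hy2 hy3
    exact ⟨hy1, hy2, hy3⟩
  · exact SMSN.isMinMSEPredictor_of_condExp (hY.prodMk hYo)
      (SMSN.Model.measurable_predictor.comp measurable_fst) hYpj fun j =>
      SMSN.condExp_prodMk_of_indepFun hY hYp hYo hind (measurable_pi_apply j) (hYpj j)
        ((measurable_pi_apply j).comp SMSN.Model.measurable_predictor) (hcond j)
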